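/- A *symmetric lens-shaped network* $M\subset\mathbb R^2$ is given by an embedded arc $\gamma:[-1,1]\to\mathbb R^2$, smooth and regular up to the boundary, with $\gamma((-1,1))\subset\{x^2>0\}$, with $\gamma(\pm1)$ on the $x^1$-axis, $x^1(\gamma(-1))<x^1(\gamma(1))$, and $$\frac{\gamma'(-1)}{|\gamma'(-1)|}=\Bigl(\tfrac12,\tfrac{\sqrt3}2\Bigr),\qquad \frac{\gamma'(1)}{|\gamma'(1)|}=\Bigl(\tfrac12,-\tfrac{\sqrt3}2\Bigr).$$ The network $M$ is the union of the arc, its reflection about the $x^1$-axis, and the two half-lines in the $x^1$-axis joining $\gamma(-1)$ to $-\infty$ and $\gamma(1)$ to $+\infty$. A *self-similarly shrinking lens* is a family $(M_t)_{t<0}$ of symmetric lens-shaped networks with arcs $\gamma_t$, where $t\mapsto\gamma_t(x)$ is differentiable for each $x\in[-1,1]$, such that * $\langle\partial_t\gamma_t,\nu\rangle=\langle(\gamma_t)_{xx},\nu\rangle/|(\gamma_t)_x|^2$ on $(-1,1)$ for all $t<0$, where $\nu$ is a unit normal to $\gamma_t$ (curve shortening flow); * for all $t_1,t_2<0$ there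 is $r>0$ with $M_{t_1}=r\,M_{t_2}$; * $M_t$ converges to the $x^1$-axis in Hausdorff distance as $t\nearrow0$. A *self-similar profile* on $[a,b]$, $a<b$, is a function $u\in C^2([a,b])$ with $u>0$ on $(a,b)$ and $$u''=(1+u'^2)(xu'-u)\ \text{ on }(a,b),\qquad u(a)=u(b)=0,\qquad u'(a)=\sqrt3,\quad u'(b)=-\sqrt3.$$ **Lemma 5.2.** There is a self-similar profile $u$ on an interval $[-b,b]$, $b>0$, with $u(-x)=u(x)$ and $u'(0)=0$, such that the networks $N_t=\sqrt{-2t}\,N$, $t<0$, form a self-similarly shrinking lens, where $N$ is the symmetric lens-shaped network with upper arc $\operatorname{graph}u$. It is unique in the class of symmetric lens-shaped networks: every self-similarly shrinking lens $(M_t)_{t<0}$ satisfies $M_t=N_t$ for all $t<0$. In particular every self-similarly shrinking lens is symmetric about the $x^2$-axis. Moreover, every self-similar profile $v$ on an interval $[a',b']$ satisfies $a'=-b$, $b'=b$ and $v=u$ on $[-b,b]$; in particular $v'(0)=0$. -/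

import Mathlib

open Set Filter Topology
open scoped ContDiff Pointwise

/-- The Euclidean plane; `p 0` and `p 1` are the coordinates `x^1` and `x^2` of `p`. -/
abbrev Plane : Type := EuclideanSpace ℝ (Fin 2)

/-- Reflection about the `x^1`-axis. -/
noncomputable def reflectAcrossX1 (p : Plane) : Plane := !₂[p 0, -p 1]

/-- Reflection about the `x^2`-axis. -/
noncomputable def reflectAcrossX2 (p : Plane) : Plane := !₂[-p 0, p 1]

/-- The `x^1`-axis. -/
def x1Axis : Set Plane := {p | p 1 = 0}

/-- `γ : [-1, 1] → ℝ²` is the upper arc of a symmetric lens-shaped network: it is smooth and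
regular up to the boundary, embedded, lies in the open upper half-plane except for its end points,
which lie on the `x^1`-axis, and meets that axis there at an angle of `60°`. -/
structure IsLensCurve (γ : ℝ → Plane) : Prop where
  smooth : ContDiffOn ℝ ∞ γ (Icc (-1) 1)
  regular : ∀ s ∈ Icc (-1 : ℝ) 1, derivWithin γ (Icc (-1) 1) s ≠ 0
  embedded : InjOn γ (Icc (-1) 1)
  upper : ∀ s ∈ Ioo (-1 : ℝ) 1, 0 < γ s 1
  left_mem : γ (-1) 1 = 0
  right_mem : γ 1 1 = 0
  left_lt_right : γ (-1) 0 < γ 1 0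
  left_angle : ‖derivWithin γ (Icc (-1) 1) (-1)‖⁻¹ • derivWithin γ (Icc (-1) 1) (-1)
    = !₂[1 / 2, √3 / 2]
  right_angle : ‖derivWithin γ (Icc (-1) 1) 1‖⁻¹ • derivWithin γ (Icc (-1) 1) 1
    = !₂[1 / 2, -(√3 / 2)]

/-- The complete symmetric network determined by its upper arc `γ`: the arc, its reflection about
the `x^1`-axis, and the two half-lines in the `x^1`-axis that join the end points of `γ` to
`-∞` and to `+∞`. -/
noncomputable def network (γ : ℝ → Plane) : Set Plane :=
  γ '' Icc (-1) 1 ∪ reflectAcrossX1 '' (γ '' Icc (-1) 1) ∪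
    {p | p 1 = 0 ∧ p 0 ≤ γ (-1) 0} ∪ {p | p 1 = 0 ∧ γ 1 0 ≤ p 0}

/-- The unit normal of the curve `γ` at the parameter `s` (the unit tangent turned by `+90°`). -/
noncomputable def unitNormal (γ : ℝ → Plane) (s : ℝ) : Plane :=
  ‖deriv γ s‖⁻¹ • !₂[-(deriv γ s 1), deriv γ s 0]

/-- The family `(γ t)`, `t < 0`, of upper arcs of symmetric lens-shaped networks evolves under
curve shortening flow, `⟨∂ₜγ, ν⟩ = ⟨γ_ss, ν⟩ / |γ_s|²` away from the vertices. -/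
structure IsLensFlow (γ : ℝ → ℝ → Plane) : Prop where
  lens : ∀ t < 0, IsLensCurve (γ t)
  differentiable : ∀ t < 0, ∀ s ∈ Icc (-1 : ℝ) 1, DifferentiableAt ℝ (fun τ => γ τ s) t
  flow : ∀ t < 0, ∀ s ∈ Ioo (-1 : ℝ) 1,
    inner ℝ (deriv (fun τ => γ τ s) t) (unitNormal (γ t) s)
      = inner ℝ (deriv (deriv (γ t)) s) (unitNormal (γ t) s) / ‖deriv (γ t) s‖ ^ 2

/-- A self-similarly shrinking lens: a curve shortening flow of symmetric lens-shaped networks on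
`(-∞, 0)` whose networks are images of each other under homotheties centred at the origin, and
converge in Hausdorff distance to the `x^1`-axis as `t ↗ 0`. -/
structure IsSelfSimilarlyShrinkingLens (γ : ℝ → ℝ → Plane) : Prop extends IsLensFlow γ where
  homothetic : ∀ t₁ < 0, ∀ t₂ < 0, ∃ r : ℝ, 0 < r ∧ network (γ t₁) = r • network (γ t₂)
  collapse : Tendsto (fun t => Metric.hausdorffEDist (network (γ t)) x1Axis) (𝓝[<] 0) (𝓝 0)

/-- `u` on `[a, b]` is the profile of a self-similarly shrinking graphical lens at time `-1/2`:
`u'' = (1 + u'²)(x u' - u)` with `u = 0` and `u' = ±√3` at the end points. -/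
structure IsSelfSimilarProfile (a b : ℝ) (u : ℝ → ℝ) : Prop where
  lt : a < b
  contDiffOn : ContDiffOn ℝ 2 u (Icc a b)
  pos : ∀ x ∈ Ioo a b, 0 < u x
  left_eq : u a = 0
  right_eq : u b = 0
  left_slope : derivWithin u (Icc a b) a = √3
  right_slope : derivWithin u (Icc a b) b = -√3
  ode : ∀ x ∈ Ioo a b, deriv (deriv u) x = (1 + deriv u x ^ 2) * (x * deriv u x - u x)

/-- The graph of `u` over `[a, b]`, parametrized over `[-1, 1]` with affine first coordinate. -/
noncomputable def graphCurve (a b : ℝ) (u : ℝ → ℝ) (s : ℝ) : Plane :=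
  !₂[((1 - s) * a + (1 + s) * b) / 2, u (((1 - s) * a + (1 + s) * b) / 2)]

/-! A shrinker at time -1/2 is a curve whose curvature equals its support function `h`. Along the
arc of a lens `h` is positive, so the angle `θ` of the normal `(sin θ, cos θ)` increases strictly
and runs from `-π/3` to `π/3`; it serves as parameter. The radius of curvature is `h + h''`, so the
shrinker equation becomes `h'' = 1/h - h`, and the condition that the end points lie on the axis
becomes `h cos θ = h' sin θ` at `θ = ±π/3`. Everything reduces to existence and uniqueness for this
boundary value problem.

Uniqueness rests on an identity for the Wronskian `W = h₁' h₂ - h₂' h₁` of two solutions: although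
the equation is nonlinear, `W' = h₂/h₁ - h₁/h₂`, so `W'' = -(1/h₁² + 1/h₂²) W` is linear. The
coordinates satisfy `X'' = -X/h²` and `Y'' = -Y/h²`, so `X₁ Y₂` solves the same linear equation with
the extra forcing `2 X₁' Y₂' = -2 sin θ cos θ / (h₁ h₂)`, which is negative for `0 < θ < π/3`. Since
`W(π/3) = 0`, Sturm comparison shows that `W` cannot have another zero in `[0, π/3)` to the right of
which `X₁ ≥ 0`, unless `W` vanishes identically. Comparing an arc with its mirror image gives
symmetry (`symm`); then `X(0) = 0` for every arc, so `W(0) = 0`, and all arcs agree (`unique`).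

Existence is by shooting in `m = h(0)` with `h'(0) = 0`. The energy `h'²/2 - log h + h²/2` is
conserved and confines `h`; at `π/3` the height `Y` is positive for `m = 1` and nonpositive for `m =
1/10`.

For a general self-similarly shrinking lens the vertices can be read off from the network, so the
homothety factor is differentiable in time. Pulled back by the homotheties, points of the moving arc
stay on one fixed arc and have tangential velocity. Hence the curvature of each slice is a constant
times its support function, and the slice is a rescaled shrinker arc. Its scale `L` satisfies `L L'
= -1`, and collapse onto the axis forces `L = √(-2t)`. -/

/-! ### Linear second order equations: uniqueness and Sturm comparison -/

/-- A nonnegative function whose derivative it dominates vanishes as soon as it has a zero. -/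
theorem eq_zero_of_abs_deriv_le {G G' : ℝ → ℝ} {a b C z : ℝ} (hc : ContinuousOn G (Icc a b))
    (hd : ∀ x ∈ Ioo a b, HasDerivAt G (G' x) x) (h0 : ∀ x ∈ Icc a b, 0 ≤ G x)
    (hle : ∀ x ∈ Ioo a b, |G' x| ≤ C * G x) (hz : z ∈ Icc a b) (hGz : G z = 0) :
    ∀ x ∈ Icc a b, G x = 0 := by
  intro x hx
  -- Gronwall with integrating factors: `G exp(-C t)` is nonincreasing to the right of `z`, and `G
  -- exp(C t)` is nondecreasing to the left of it.
  have key : ∀ σ : ℝ, ∀ y ∈ Ioo a b, HasDerivAt (fun t => G t * Real.exp (σ * t))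
      ((G' y + σ * G y) * Real.exp (σ * y)) y := by
    intro σ y hy
    have h1 : HasDerivAt (fun t : ℝ => Real.exp (σ * t)) (Real.exp (σ * y) * (σ * 1)) y :=
      ((hasDerivAt_id' y).const_mul σ).exp
    exact ((hd y hy).mul h1).congr_deriv (by ring)
  have hcc : ∀ σ : ℝ, ContinuousOn (fun t => G t * Real.exp (σ * t)) (Icc a b) := fun σ =>
    hc.mul (by fun_prop)
  rcases le_total z x with h | h
  · have hanti : AntitoneOn (fun t => G t * Real.exp (-C * t)) (Icc z b) := by
      apply antitoneOn_of_deriv_nonpos (convex_Icc _ _)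
      · exact (hcc _).mono (Icc_subset_Icc_left hz.1)
      · intro y hy
        rw [interior_Icc] at hy
        exact (key _ y ⟨hz.1.trans_lt hy.1, hy.2⟩).differentiableAt.differentiableWithinAt
      · intro y hy
        rw [interior_Icc] at hy
        have hy' : y ∈ Ioo a b := ⟨hz.1.trans_lt hy.1, hy.2⟩
        rw [(key _ y hy').deriv]
        have := (abs_le.1 (hle y hy')).2
        exact mul_nonpos_of_nonpos_of_nonneg (by linarith) (Real.exp_pos _).le
    have := hanti (left_mem_Icc.2 hz.2) ⟨h, hx.2⟩ h
    simp only [hGz, zero_mul] at this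
    have h3 := h0 x hx
    have h4 := Real.exp_pos (-C * x)
    nlinarith
  · have hmono : MonotoneOn (fun t => G t * Real.exp (C * t)) (Icc a z) := by
      apply monotoneOn_of_deriv_nonneg (convex_Icc _ _)
      · exact (hcc _).mono (Icc_subset_Icc_right hz.2)
      · intro y hy
        rw [interior_Icc] at hy
        exact (key _ y ⟨hy.1, hy.2.trans_le hz.2⟩).differentiableAt.differentiableWithinAt
      · intro y hy
        rw [interior_Icc] at hy
        have hy' : y ∈ Ioo a b := ⟨hy.1, hy.2.trans_le hz.2⟩
        rw [(key _ y hy').deriv]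
        have := (abs_le.1 (hle y hy')).1
        exact mul_nonneg (by linarith) (Real.exp_pos _).le
    have := hmono ⟨hx.1, h⟩ (right_mem_Icc.2 hz.1) h
    simp only [hGz, zero_mul] at this
    have h3 := h0 x hx
    have h4 := Real.exp_pos (C * x)
    nlinarith

/-- Uniqueness for the linear system `W' = V`, `V' = -k W`. -/
theorem linear_system_eq_zero {W V k : ℝ → ℝ} {a b z : ℝ} (hW : ContinuousOn W (Icc a b))
    (hV : ContinuousOn V (Icc a b)) (hk : ContinuousOn k (Icc a b))
    (hW' : ∀ x ∈ Ioo a b, HasDerivAt W (V x) x)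
    (hV' : ∀ x ∈ Ioo a b, HasDerivAt V (-k x * W x) x)
    (hz : z ∈ Icc a b) (hWz : W z = 0) (hVz : V z = 0) :
    ∀ x ∈ Icc a b, W x = 0 ∧ V x = 0 := by
  obtain ⟨K, hK⟩ := isCompact_Icc.exists_bound_of_continuousOn hk
  have := eq_zero_of_abs_deriv_le (G := fun x => W x ^ 2 + V x ^ 2)
    (G' := fun x => 2 * W x * V x * (1 - k x)) (C := 1 + K) ((hW.pow 2).add (hV.pow 2))
    (fun x hx => (((hW' x hx).pow 2).add ((hV' x hx).pow 2)).congr_deriv (by push_cast; ring))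
    (fun x _ => by positivity)
    (fun x hx => by
      have h1 : |1 - k x| ≤ 1 + K := by
        have := hK x (Ioo_subset_Icc_self hx)
        rw [Real.norm_eq_abs] at this
        calc |1 - k x| ≤ |1| + |k x| := abs_sub _ _
          _ ≤ 1 + K := by simpa using this
      have h2 : |2 * W x * V x| ≤ W x ^ 2 + V x ^ 2 := by
        rw [abs_le]; constructor <;> nlinarith [sq_nonneg (W x - V x), sq_nonneg (W x + V x)]
      rw [abs_mul, mul_comm]
      exact mul_le_mul h1 h2 (abs_nonneg _) ((abs_nonneg _).trans h1))
    hz (by simp [hWz, hVz])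
  intro x hx
  have h : W x ^ 2 + V x ^ 2 = 0 := this x hx
  constructor <;> nlinarith [sq_nonneg (W x), sq_nonneg (V x)]

/-- Sturm comparison: a solution `W` of `W'' = -k W` with `W z = W e = 0` and `W' z > 0` is
incompatible with a nonnegative strict supersolution. -/
theorem sturm_contradiction {W V k y Y f : ℝ → ℝ} {z e : ℝ} (hze : z < e)
    (hW : ContinuousOn W (Icc z e)) (hV : ContinuousOn V (Icc z e))
    (hy : ContinuousOn y (Icc z e)) (hY : ContinuousOn Y (Icc z e))
    (hW' : ∀ x ∈ Ioo z e, HasDerivAt W (V x) x)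
    (hV' : ∀ x ∈ Ioo z e, HasDerivAt V (-k x * W x) x)
    (hy' : ∀ x ∈ Ioo z e, HasDerivAt y (Y x) x)
    (hY' : ∀ x ∈ Ioo z e, HasDerivAt Y (-k x * y x - f x) x)
    (hf : ∀ x ∈ Ioo z e, 0 < f x) (hy0 : ∀ x ∈ Icc z e, 0 ≤ y x)
    (hWz : W z = 0) (hWe : W e = 0) (hVz : 0 < V z) : False := by
  have hVpos : ∃ δ > z, δ < e ∧ ∀ x ∈ Icc z δ, 0 < V x := by
    have h1 : ∀ᶠ x in 𝓝[Icc z e] z, 0 < V x :=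
      (hV z (left_mem_Icc.2 hze.le)).eventually_const_lt hVz
    rw [nhdsWithin_Icc_eq_nhdsGE hze] at h1
    obtain ⟨u, hu, hu'⟩ := (mem_nhdsGE_iff_exists_Icc_subset).1 h1
    refine ⟨min u ((z + e) / 2), lt_min hu (by linarith), (min_le_right _ _).trans_lt (by linarith),
      fun x hx => hu' ⟨hx.1, hx.2.trans (min_le_left _ _)⟩⟩
  obtain ⟨δ, hδz, hδe, hδ⟩ := hVpos
  have hmono : StrictMonoOn W (Icc z δ) := by
    apply strictMonoOn_of_deriv_pos (convex_Icc _ _) (hW.mono (Icc_subset_Icc_right hδe.le))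
    intro x hx
    rw [interior_Icc] at hx
    rw [(hW' x ⟨hx.1, hx.2.trans hδe⟩).deriv]
    exact hδ x (Ioo_subset_Icc_self hx)
  have hWδ : ∀ x ∈ Ioc z δ, 0 < W x := fun x hx => by
    have := hmono (left_mem_Icc.2 hδz.le) ⟨hx.1.le, hx.2⟩ hx.1
    rwa [hWz] at this
  -- The comparison takes place up to the first zero `c` of `W` after `z`, where `V c ≤ 0`.
  let S : Set ℝ := Icc δ e ∩ W ⁻¹' Iic 0
  have hSclosed : IsCompact S :=
    isCompact_Icc.of_isClosed_subset
      ((hW.mono (Icc_subset_Icc_left hδz.le)).preimage_isClosed_of_isClosed isClosed_Icc isClosed_Iic)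
      inter_subset_left
  have hSne : S.Nonempty := ⟨e, right_mem_Icc.2 hδe.le, by simp [hWe]⟩
  obtain ⟨c, hcS, hcmin⟩ := hSclosed.exists_isLeast hSne
  have hδc : δ < c := by
    rcases hcS.1.1.eq_or_lt with h | h
    · exact absurd hcS.2 (by simpa [← h] using hWδ δ ⟨hδz, le_rfl⟩)
    · exact h
  have hzc : z < c := hδz.trans hδc
  have hWpos : ∀ x ∈ Ioo z c, 0 < W x := by
    intro x hx
    rcases le_or_gt x δ with h | h
    · exact hWδ x ⟨hx.1, h⟩
    · by_contra hneg
      exact absurd (hcmin ⟨⟨h.le, hx.2.le.trans hcS.1.2⟩, not_lt.1 hneg⟩) (not_le.2 hx.2)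
  have hsub : Icc z c ⊆ Icc z e := Icc_subset_Icc_right hcS.1.2
  have hsub' : Ioo z c ⊆ Ioo z e := Ioo_subset_Ioo_right hcS.1.2
  have hWc : W c = 0 := by
    refine le_antisymm hcS.2 ?_
    have hcl : c ∈ closure (Ioo z c) := by rw [closure_Ioo hzc.ne]; exact right_mem_Icc.2 hzc.le
    exact ContinuousWithinAt.closure_le hcl continuousWithinAt_const
      ((hW c (hsub (right_mem_Icc.2 hzc.le))).mono (Ioo_subset_Icc_self.trans hsub))
      (fun x hx => (hWpos x hx).le)
  have hVc : V c ≤ 0 := by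
    by_contra hpos
    rw [not_le] at hpos
    have h1 : ∀ᶠ x in 𝓝[Icc z c] c, 0 < V x :=
      ((hV.mono hsub) c (right_mem_Icc.2 hzc.le)).eventually_const_lt hpos
    rw [nhdsWithin_Icc_eq_nhdsLE hzc] at h1
    obtain ⟨u, hu, hu'⟩ := (mem_nhdsLE_iff_exists_Icc_subset).1 h1
    have hm : max u ((z + c) / 2) < c := max_lt hu (by linarith)
    have hzm : z < max u ((z + c) / 2) := lt_max_of_lt_right (by linarith)
    have : StrictMonoOn W (Icc (max u ((z + c) / 2)) c) := by
      apply strictMonoOn_of_deriv_pos (convex_Icc _ _)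
        (hW.mono ((Icc_subset_Icc_left hzm.le).trans hsub))
      intro x hx
      rw [interior_Icc] at hx
      rw [(hW' x (hsub' ⟨hzm.trans hx.1, hx.2⟩)).deriv]
      exact hu' ⟨(le_max_left _ _).trans hx.1.le, hx.2.le⟩
    have h2 := this (left_mem_Icc.2 hm.le) (right_mem_Icc.2 hm.le) hm
    have h3 := hWpos _ ⟨hzm, hm⟩
    linarith
  -- The Wronskian `W Y - y V` has derivative `-W f < 0` on `(z, c)`, yet it is `-y V ≤ 0` at `z`
  -- and `-y V ≥ 0` at `c`.
  have hanti : StrictAntiOn (fun x => W x * Y x - y x * V x) (Icc z c) := by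
    apply strictAntiOn_of_deriv_neg (convex_Icc _ _)
    · exact ((hW.mul hY).sub (hy.mul hV)).mono hsub
    · intro x hx
      rw [interior_Icc] at hx
      have hx' := hsub' hx
      have : HasDerivAt (fun x => W x * Y x - y x * V x) (-(W x * f x)) x :=
        (((hW' x hx').mul (hY' x hx')).sub ((hy' x hx').mul (hV' x hx'))).congr_deriv (by ring)
      rw [this.deriv]
      have := mul_pos (hWpos x hx) (hf x hx')
      linarith
  have h := hanti (left_mem_Icc.2 hzc.le) (right_mem_Icc.2 hzc.le) hzc
  simp only [hWz, hWc] at h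
  have h1 := mul_nonneg (hy0 z (left_mem_Icc.2 hze.le)) hVz.le
  have h2 := mul_nonneg (hy0 c (hsub (right_mem_Icc.2 hzc.le))) (neg_nonneg.2 hVc)
  linarith

/-! ### Shrinker arcs parametrized by the normal angle: symmetry and uniqueness -/

/-- The support function `h` of the curve `(X, Y)`, parametrized by the angle `θ` of its normal. -/
noncomputable def supportFn (X Y : ℝ → ℝ) (θ : ℝ) : ℝ := X θ * Real.sin θ + Y θ * Real.cos θ

/-- The derivative of the support function. -/
noncomputable def supportDeriv (X Y : ℝ → ℝ) (θ : ℝ) : ℝ := X θ * Real.cos θ - Y θ * Real.sin θ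

/-- A shrinker `(X, Y)` in the upper half-plane, parametrized by the angle `θ ∈ [-π/3, π/3]`
of its normal, whose end points lie on the first axis. -/
structure IsShrinkerArc (X Y : ℝ → ℝ) : Prop where
  contX : ContinuousOn X (Icc (-(Real.pi / 3)) (Real.pi / 3))
  contY : ContinuousOn Y (Icc (-(Real.pi / 3)) (Real.pi / 3))
  derivX : ∀ θ ∈ Ioo (-(Real.pi / 3)) (Real.pi / 3),
    HasDerivAt X (Real.cos θ / supportFn X Y θ) θ
  derivY : ∀ θ ∈ Ioo (-(Real.pi / 3)) (Real.pi / 3),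
    HasDerivAt Y (-Real.sin θ / supportFn X Y θ) θ
  pos : ∀ θ ∈ Icc (-(Real.pi / 3)) (Real.pi / 3), 0 < supportFn X Y θ
  left_eq : Y (-(Real.pi / 3)) = 0
  right_eq : Y (Real.pi / 3) = 0

namespace IsShrinkerArc

open Real (pi_pos)

variable {X Y X₁ Y₁ X₂ Y₂ : ℝ → ℝ}

theorem cont_support (H : IsShrinkerArc X Y) :
    ContinuousOn (supportFn X Y) (Icc (-(Real.pi / 3)) (Real.pi / 3)) :=
  (H.contX.mul Real.continuous_sin.continuousOn).add
    (H.contY.mul Real.continuous_cos.continuousOn)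

theorem cont_supportDeriv (H : IsShrinkerArc X Y) :
    ContinuousOn (supportDeriv X Y) (Icc (-(Real.pi / 3)) (Real.pi / 3)) :=
  (H.contX.mul Real.continuous_cos.continuousOn).sub
    (H.contY.mul Real.continuous_sin.continuousOn)

theorem hasDerivAt_support (H : IsShrinkerArc X Y) {θ : ℝ}
    (hθ : θ ∈ Ioo (-(Real.pi / 3)) (Real.pi / 3)) :
    HasDerivAt (supportFn X Y) (supportDeriv X Y θ) θ :=
  (((H.derivX θ hθ).mul (Real.hasDerivAt_sin θ)).add
    ((H.derivY θ hθ).mul (Real.hasDerivAt_cos θ))).congr_deriv (by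
      unfold supportDeriv; ring)

/-- This is the shrinker equation `h'' + h = 1/h`: the radius of curvature `h'' + h` is the
reciprocal of the curvature `h`. -/
theorem hasDerivAt_supportDeriv (H : IsShrinkerArc X Y) {θ : ℝ}
    (hθ : θ ∈ Ioo (-(Real.pi / 3)) (Real.pi / 3)) :
    HasDerivAt (supportDeriv X Y) (1 / supportFn X Y θ - supportFn X Y θ) θ := by
  refine (((H.derivX θ hθ).mul (Real.hasDerivAt_cos θ)).sub
    ((H.derivY θ hθ).mul (Real.hasDerivAt_sin θ))).congr_deriv ?_
  have h1 : 1 / supportFn X Y θ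
      = (Real.sin θ ^ 2 + Real.cos θ ^ 2) / supportFn X Y θ := by
    rw [Real.sin_sq_add_cos_sq]
  rw [h1]
  conv_rhs => rw [supportFn]
  unfold supportFn
  ring

/-- The Wronskian of two support functions. -/
noncomputable def wronskian (X₁ Y₁ X₂ Y₂ : ℝ → ℝ) (θ : ℝ) : ℝ :=
  supportDeriv X₁ Y₁ θ * supportFn X₂ Y₂ θ - supportDeriv X₂ Y₂ θ * supportFn X₁ Y₁ θ

/-- The derivative of the Wronskian of two support functions. -/
noncomputable def wronskianDeriv (X₁ Y₁ X₂ Y₂ : ℝ → ℝ) (θ : ℝ) : ℝ :=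
  supportFn X₂ Y₂ θ / supportFn X₁ Y₁ θ - supportFn X₁ Y₁ θ / supportFn X₂ Y₂ θ

theorem hasDerivAt_wronskian (H₁ : IsShrinkerArc X₁ Y₁) (H₂ : IsShrinkerArc X₂ Y₂) {θ : ℝ}
    (hθ : θ ∈ Ioo (-(Real.pi / 3)) (Real.pi / 3)) :
    HasDerivAt (wronskian X₁ Y₁ X₂ Y₂) (wronskianDeriv X₁ Y₁ X₂ Y₂ θ) θ :=
  (((H₁.hasDerivAt_supportDeriv hθ).mul (H₂.hasDerivAt_support hθ)).sub
    ((H₂.hasDerivAt_supportDeriv hθ).mul (H₁.hasDerivAt_support hθ))).congr_deriv (by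
      unfold wronskianDeriv; ring)

/-- The quotients satisfy `(h₂/h₁)' = -W/h₁²` and `(h₁/h₂)' = W/h₂²`, so the nonlinear equation
yields a linear one for `W`. -/
theorem hasDerivAt_wronskianDeriv (H₁ : IsShrinkerArc X₁ Y₁) (H₂ : IsShrinkerArc X₂ Y₂) {θ : ℝ}
    (hθ : θ ∈ Ioo (-(Real.pi / 3)) (Real.pi / 3)) :
    HasDerivAt (wronskianDeriv X₁ Y₁ X₂ Y₂)
      (-(1 / supportFn X₁ Y₁ θ ^ 2 + 1 / supportFn X₂ Y₂ θ ^ 2) * wronskian X₁ Y₁ X₂ Y₂ θ) θ := by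
  have h1 := (H₁.pos θ (Ioo_subset_Icc_self hθ)).ne'
  have h2 := (H₂.pos θ (Ioo_subset_Icc_self hθ)).ne'
  refine (((H₂.hasDerivAt_support hθ).div (H₁.hasDerivAt_support hθ) h1).sub
    ((H₁.hasDerivAt_support hθ).div (H₂.hasDerivAt_support hθ) h2)).congr_deriv ?_
  unfold wronskian
  field_simp
  ring

theorem cont_wronskian (H₁ : IsShrinkerArc X₁ Y₁) (H₂ : IsShrinkerArc X₂ Y₂) :
    ContinuousOn (wronskian X₁ Y₁ X₂ Y₂) (Icc (-(Real.pi / 3)) (Real.pi / 3)) :=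
  (H₁.cont_supportDeriv.mul H₂.cont_support).sub (H₂.cont_supportDeriv.mul H₁.cont_support)

theorem cont_wronskianDeriv (H₁ : IsShrinkerArc X₁ Y₁) (H₂ : IsShrinkerArc X₂ Y₂) :
    ContinuousOn (wronskianDeriv X₁ Y₁ X₂ Y₂) (Icc (-(Real.pi / 3)) (Real.pi / 3)) :=
  (H₂.cont_support.div H₁.cont_support fun θ hθ => (H₁.pos θ hθ).ne').sub
    (H₁.cont_support.div H₂.cont_support fun θ hθ => (H₂.pos θ hθ).ne')

/-- Both arcs satisfy the same homogeneous Robin condition `h cos θ = h' sin θ` at `π/3`. -/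
theorem wronskian_right (H₁ : IsShrinkerArc X₁ Y₁) (H₂ : IsShrinkerArc X₂ Y₂) :
    wronskian X₁ Y₁ X₂ Y₂ (Real.pi / 3) = 0 := by
  unfold wronskian supportFn supportDeriv
  rw [H₁.right_eq, H₂.right_eq]
  ring

/-- The data of the curve in terms of its support function. -/
theorem X_eq (X Y : ℝ → ℝ) (θ : ℝ) :
    X θ = supportFn X Y θ * Real.sin θ + supportDeriv X Y θ * Real.cos θ := by
  unfold supportFn supportDeriv
  linear_combination (-X θ) * Real.sin_sq_add_cos_sq θ

theorem Y_eq (X Y : ℝ → ℝ) (θ : ℝ) :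
    Y θ = supportFn X Y θ * Real.cos θ - supportDeriv X Y θ * Real.sin θ := by
  unfold supportFn supportDeriv
  linear_combination (-Y θ) * Real.sin_sq_add_cos_sq θ

/-- Two arcs whose support functions agree to first order at one angle coincide. -/
theorem eqOn_of_wronskian_eq_zero (H₁ : IsShrinkerArc X₁ Y₁) (H₂ : IsShrinkerArc X₂ Y₂) {z : ℝ}
    (hz : z ∈ Icc (-(Real.pi / 3)) (Real.pi / 3)) (hW : wronskian X₁ Y₁ X₂ Y₂ z = 0)
    (hV : wronskianDeriv X₁ Y₁ X₂ Y₂ z = 0) :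
    EqOn X₁ X₂ (Icc (-(Real.pi / 3)) (Real.pi / 3)) ∧
      EqOn Y₁ Y₂ (Icc (-(Real.pi / 3)) (Real.pi / 3)) := by
  have key := linear_system_eq_zero (H₁.cont_wronskian H₂) (H₁.cont_wronskianDeriv H₂)
    (k := fun θ => 1 / supportFn X₁ Y₁ θ ^ 2 + 1 / supportFn X₂ Y₂ θ ^ 2)
    ((continuousOn_const.div (H₁.cont_support.pow 2)
      fun θ hθ => (pow_pos (H₁.pos θ hθ) 2).ne').add
      (continuousOn_const.div (H₂.cont_support.pow 2)
      fun θ hθ => (pow_pos (H₂.pos θ hθ) 2).ne'))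
    (fun θ hθ => H₁.hasDerivAt_wronskian H₂ hθ) (fun θ hθ => H₁.hasDerivAt_wronskianDeriv H₂ hθ)
    hz hW hV
  -- `W' = 0` means `h₁² = h₂²`; afterwards `W = 0` gives equality of the derivatives.
  have hh : ∀ θ ∈ Icc (-(Real.pi / 3)) (Real.pi / 3), supportFn X₁ Y₁ θ = supportFn X₂ Y₂ θ := by
    intro θ hθ
    have h := (key θ hθ).2
    unfold wronskianDeriv at h
    have h1 := H₁.pos θ hθ
    have h2 := H₂.pos θ hθ
    field_simp at h
    nlinarith
  have hp : ∀ θ ∈ Icc (-(Real.pi / 3)) (Real.pi / 3),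
      supportDeriv X₁ Y₁ θ = supportDeriv X₂ Y₂ θ := by
    intro θ hθ
    have h := (key θ hθ).1
    unfold wronskian at h
    rw [hh θ hθ, ← sub_mul] at h
    rcases mul_eq_zero.1 h with h | h
    · linarith
    · exact absurd h (H₂.pos θ hθ).ne'
  constructor <;> intro θ hθ
  · rw [X_eq X₁ Y₁, X_eq X₂ Y₂, hh θ hθ, hp θ hθ]
  · rw [Y_eq X₁ Y₁, Y_eq X₂ Y₂, hh θ hθ, hp θ hθ]

theorem reflect (H : IsShrinkerArc X Y) : IsShrinkerArc (fun θ => -X (-θ)) (fun θ => Y (-θ)) := by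
  have hs : ∀ θ, supportFn (fun θ => -X (-θ)) (fun θ => Y (-θ)) θ = supportFn X Y (-θ) := by
    intro θ; simp [supportFn]
  have hm : MapsTo (fun θ : ℝ => -θ) (Icc (-(Real.pi / 3)) (Real.pi / 3))
      (Icc (-(Real.pi / 3)) (Real.pi / 3)) := fun θ hθ => ⟨by linarith [hθ.2], by linarith [hθ.1]⟩
  have hm' : ∀ θ ∈ Ioo (-(Real.pi / 3)) (Real.pi / 3), -θ ∈ Ioo (-(Real.pi / 3)) (Real.pi / 3) :=
    fun θ hθ => ⟨by linarith [hθ.2], by linarith [hθ.1]⟩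
  refine ⟨(H.contX.comp continuous_neg.continuousOn hm).neg,
    H.contY.comp continuous_neg.continuousOn hm, ?_, ?_, ?_, ?_, ?_⟩
  · intro θ hθ
    rw [hs]
    exact ((H.derivX _ (hm' θ hθ)).scomp θ (hasDerivAt_neg θ)).neg.congr_deriv (by simp)
  · intro θ hθ
    rw [hs]
    exact ((H.derivY _ (hm' θ hθ)).scomp θ (hasDerivAt_neg θ)).congr_deriv (by simp [neg_div])
  · intro θ hθ
    rw [hs]
    exact H.pos _ (hm hθ)
  · simpa using H.right_eq
  · simpa using H.left_eq

theorem cos_pos_of_mem {θ : ℝ} (hθ : θ ∈ Icc (-(Real.pi / 3)) (Real.pi / 3)) : 0 < Real.cos θ :=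
  Real.cos_pos_of_mem_Ioo ⟨by linarith [hθ.1, pi_pos], by linarith [hθ.2, pi_pos]⟩

theorem sin_pos_of_mem {θ : ℝ} (h0 : 0 < θ) (hθ : θ ≤ Real.pi / 3) : 0 < Real.sin θ :=
  Real.sin_pos_of_pos_of_lt_pi h0 (by linarith [pi_pos])

theorem strictMonoOn_X (H : IsShrinkerArc X Y) :
    StrictMonoOn X (Icc (-(Real.pi / 3)) (Real.pi / 3)) := by
  apply strictMonoOn_of_deriv_pos (convex_Icc _ _) H.contX
  intro θ hθ
  rw [interior_Icc] at hθ
  rw [(H.derivX θ hθ).deriv]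
  exact div_pos (cos_pos_of_mem (Ioo_subset_Icc_self hθ)) (H.pos θ (Ioo_subset_Icc_self hθ))

theorem strictAntiOn_Y (H : IsShrinkerArc X Y) : StrictAntiOn Y (Icc 0 (Real.pi / 3)) := by
  have h0 := pi_pos
  apply strictAntiOn_of_deriv_neg (convex_Icc _ _)
    (H.contY.mono (Icc_subset_Icc_left (by linarith)))
  intro θ hθ
  rw [interior_Icc] at hθ
  have hθ' : θ ∈ Ioo (-(Real.pi / 3)) (Real.pi / 3) := ⟨by linarith [hθ.1], hθ.2⟩
  rw [(H.derivY θ hθ').deriv]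
  exact div_neg_of_neg_of_pos (neg_lt_zero.2 (sin_pos_of_mem hθ.1 hθ.2.le))
    (H.pos θ (Ioo_subset_Icc_self hθ'))

theorem Y_pos_of_nonneg (H : IsShrinkerArc X Y) {θ : ℝ} (h0 : 0 ≤ θ) (hθ : θ < Real.pi / 3) :
    0 < Y θ := by
  have := H.strictAntiOn_Y ⟨h0, hθ.le⟩ ⟨by linarith [pi_pos], le_rfl⟩ hθ
  rwa [H.right_eq] at this

theorem Y_nonneg (H : IsShrinkerArc X Y) {θ : ℝ} (h0 : 0 ≤ θ) (hθ : θ ≤ Real.pi / 3) :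
    0 ≤ Y θ := by
  rcases hθ.eq_or_lt with h | h
  · rw [h, H.right_eq]
  · exact (H.Y_pos_of_nonneg h0 h).le

/-- The Sturm comparison with the product of coordinate functions. -/
theorem wronskianDeriv_eq_zero (H₁ : IsShrinkerArc X₁ Y₁) (H₂ : IsShrinkerArc X₂ Y₂) {z : ℝ}
    (hz : 0 ≤ z) (hz' : z < Real.pi / 3) (hX : ∀ θ ∈ Icc z (Real.pi / 3), 0 ≤ X₁ θ)
    (hW : wronskian X₁ Y₁ X₂ Y₂ z = 0) : wronskianDeriv X₁ Y₁ X₂ Y₂ z = 0 := by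
  have h0 := pi_pos
  have hI : Icc z (Real.pi / 3) ⊆ Icc (-(Real.pi / 3)) (Real.pi / 3) :=
    Icc_subset_Icc_left (by linarith)
  have hI' : Ioo z (Real.pi / 3) ⊆ Ioo (-(Real.pi / 3)) (Real.pi / 3) :=
    Ioo_subset_Ioo_left (by linarith)
  have hne₁ := fun θ hθ => (H₁.pos θ (hI hθ)).ne'
  have hne₂ := fun θ hθ => (H₂.pos θ (hI hθ)).ne'
  have cX := H₁.contX.mono hI
  have cY := H₂.contY.mono hI
  -- The supersolution takes one coordinate from each arc: `X₁'' = -X₁/h₁²` and `Y₂'' = -Y₂/h₂²`, so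
  -- the two coefficients add up to that of the Wronskian, and the cross term `2 X₁' Y₂'` is the
  -- negative forcing.
  have cy : ContinuousOn (fun θ => X₁ θ * Y₂ θ) (Icc z (Real.pi / 3)) := cX.mul cY
  have cY' : ContinuousOn (fun θ => Real.cos θ / supportFn X₁ Y₁ θ * Y₂ θ
      + X₁ θ * (-Real.sin θ / supportFn X₂ Y₂ θ)) (Icc z (Real.pi / 3)) :=
    (((Real.continuous_cos.continuousOn).div (H₁.cont_support.mono hI) hne₁).mul cY).add
      (cX.mul ((Real.continuous_sin.continuousOn.neg).div (H₂.cont_support.mono hI) hne₂))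
  have dy : ∀ θ ∈ Ioo z (Real.pi / 3), HasDerivAt (fun θ => X₁ θ * Y₂ θ)
      (Real.cos θ / supportFn X₁ Y₁ θ * Y₂ θ + X₁ θ * (-Real.sin θ / supportFn X₂ Y₂ θ)) θ :=
    fun θ hθ => (H₁.derivX θ (hI' hθ)).mul (H₂.derivY θ (hI' hθ))
  have dY : ∀ θ ∈ Ioo z (Real.pi / 3), HasDerivAt (fun θ => Real.cos θ / supportFn X₁ Y₁ θ * Y₂ θ
      + X₁ θ * (-Real.sin θ / supportFn X₂ Y₂ θ))
      (-(1 / supportFn X₁ Y₁ θ ^ 2 + 1 / supportFn X₂ Y₂ θ ^ 2) * (X₁ θ * Y₂ θ)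
        - 2 * Real.sin θ * Real.cos θ / (supportFn X₁ Y₁ θ * supportFn X₂ Y₂ θ)) θ := by
    intro θ hθ
    have n1 := hne₁ θ (Ioo_subset_Icc_self hθ)
    have n2 := hne₂ θ (Ioo_subset_Icc_self hθ)
    refine (((((Real.hasDerivAt_cos θ).div (H₁.hasDerivAt_support (hI' hθ)) n1)).mul
      (H₂.derivY θ (hI' hθ))).add ((H₁.derivX θ (hI' hθ)).mul
      ((Real.hasDerivAt_sin θ).neg.div (H₂.hasDerivAt_support (hI' hθ)) n2))).congr_deriv ?_
    simp only [Pi.div_apply, Pi.neg_apply]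
    have e1 := X_eq X₁ Y₁ θ
    have e2 := Y_eq X₂ Y₂ θ
    generalize supportFn X₁ Y₁ θ = h1 at *
    generalize supportFn X₂ Y₂ θ = h2 at *
    generalize supportDeriv X₁ Y₁ θ = p1 at *
    generalize supportDeriv X₂ Y₂ θ = p2 at *
    rw [e1, e2]
    field_simp
    ring
  have hf : ∀ θ ∈ Ioo z (Real.pi / 3),
      0 < 2 * Real.sin θ * Real.cos θ / (supportFn X₁ Y₁ θ * supportFn X₂ Y₂ θ) := by
    intro θ hθ
    have h1 := H₁.pos θ (Ioo_subset_Icc_self (hI' hθ))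
    have h2 := H₂.pos θ (Ioo_subset_Icc_self (hI' hθ))
    have h3 := sin_pos_of_mem (hz.trans_lt hθ.1) hθ.2.le
    have h4 := cos_pos_of_mem (Ioo_subset_Icc_self (hI' hθ))
    positivity
  have hy0 : ∀ θ ∈ Icc z (Real.pi / 3), 0 ≤ X₁ θ * Y₂ θ := fun θ hθ =>
    mul_nonneg (hX θ hθ) (H₂.Y_nonneg (hz.trans hθ.1) hθ.2)
  have cW := (H₁.cont_wronskian H₂).mono hI
  have cV := (H₁.cont_wronskianDeriv H₂).mono hI
  rcases lt_trichotomy (wronskianDeriv X₁ Y₁ X₂ Y₂ z) 0 with h | h | h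
  · exact (sturm_contradiction hz' cW.neg cV.neg cy cY'
      (fun θ hθ => (H₁.hasDerivAt_wronskian H₂ (hI' hθ)).neg)
      (fun θ hθ => (H₁.hasDerivAt_wronskianDeriv H₂ (hI' hθ)).neg.congr_deriv
        (by simp only [Pi.neg_apply]; ring)) dy dY hf hy0
      (by simp [hW]) (by simp [H₁.wronskian_right H₂]) (by simpa using h)).elim
  · exact h
  · exact (sturm_contradiction hz' cW cV cy cY'
      (fun θ hθ => H₁.hasDerivAt_wronskian H₂ (hI' hθ))
      (fun θ hθ => H₁.hasDerivAt_wronskianDeriv H₂ (hI' hθ)) dy dY hf hy0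
      hW (H₁.wronskian_right H₂) h).elim

/-- An arc with `X 0 ≥ 0` is symmetric about the second axis. -/
theorem symm_of_nonneg (H : IsShrinkerArc X Y) (h0 : 0 ≤ X 0) :
    EqOn X (fun θ => -X (-θ)) (Icc (-(Real.pi / 3)) (Real.pi / 3)) ∧
      EqOn Y (fun θ => Y (-θ)) (Icc (-(Real.pi / 3)) (Real.pi / 3)) := by
  have hpi := pi_pos
  have H₂ := H.reflect
  have hI : Icc 0 (Real.pi / 3) ⊆ Icc (-(Real.pi / 3)) (Real.pi / 3) :=
    Icc_subset_Icc_left (by linarith)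
  have hI' : Ioo 0 (Real.pi / 3) ⊆ Ioo (-(Real.pi / 3)) (Real.pi / 3) :=
    Ioo_subset_Ioo_left (by linarith)
  have hX : ∀ θ ∈ Icc 0 (Real.pi / 3), 0 ≤ X θ := fun θ hθ =>
    h0.trans (H.strictMonoOn_X.monotoneOn (hI ⟨le_rfl, by linarith⟩) (hI hθ) hθ.1)
  have hV0 : wronskianDeriv X Y (fun θ => -X (-θ)) (fun θ => Y (-θ)) 0 = 0 := by
    simp [wronskianDeriv, supportFn]
  -- The support function of the mirror image is `h(-θ)`, so `W'(0) = 0` and `W(0) = 2 X(0) Y(0) ≥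
  -- 0`. It remains to find a zero of `W` before `π/3`.
  have key : ∃ z, 0 ≤ z ∧ z < Real.pi / 3 ∧
      wronskian X Y (fun θ => -X (-θ)) (fun θ => Y (-θ)) z = 0 := by
    by_contra! hno
    have hY0 : 0 < Y 0 := H.Y_pos_of_nonneg le_rfl (by linarith)
    have hW0 : 0 < wronskian X Y (fun θ => -X (-θ)) (fun θ => Y (-θ)) 0 := by
      refine lt_of_le_of_ne ?_ (hno 0 le_rfl (by linarith)).symm
      simp only [wronskian, supportDeriv, supportFn]
      simp
      nlinarith
    have hWpos : ∀ θ ∈ Ioo 0 (Real.pi / 3),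
        0 < wronskian X Y (fun θ => -X (-θ)) (fun θ => Y (-θ)) θ := by
      intro θ hθ
      by_contra hneg
      obtain ⟨c, hc, hc'⟩ := intermediate_value_Icc' hθ.1.le
        ((H.cont_wronskian H₂).mono ((Icc_subset_Icc_right hθ.2.le).trans hI))
        ⟨not_lt.1 hneg, hW0.le⟩
      exact hno c hc.1 (hc.2.trans_lt hθ.2) hc'
    -- Comparison with `Y`, which satisfies `Y'' = -Y/h₁²` with a smaller coefficient: `W Y' - Y W'`
    -- has derivative `W Y / h₂² > 0`. It vanishes at `0` because `sin 0 = 0` and `W'(0) = 0`, and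
    -- at `π/3` because `W = Y = 0` there.
    have hmono : StrictMonoOn (fun θ => wronskian X Y (fun θ => -X (-θ)) (fun θ => Y (-θ)) θ
        * (-Real.sin θ / supportFn X Y θ)
        - Y θ * wronskianDeriv X Y (fun θ => -X (-θ)) (fun θ => Y (-θ)) θ)
        (Icc 0 (Real.pi / 3)) := by
      apply strictMonoOn_of_deriv_pos (convex_Icc _ _)
      · refine ContinuousOn.mono ?_ hI
        exact ((H.cont_wronskian H₂).mul (Real.continuous_sin.continuousOn.neg.div H.cont_support
          fun θ hθ => (H.pos θ hθ).ne')).sub (H.contY.mul (H.cont_wronskianDeriv H₂))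
      · intro θ hθ
        rw [interior_Icc] at hθ
        have hθ' := hI' hθ
        have n1 := H.pos θ (Ioo_subset_Icc_self hθ')
        have n2 := H₂.pos θ (Ioo_subset_Icc_self hθ')
        have hd := ((H.hasDerivAt_wronskian H₂ hθ').mul ((Real.hasDerivAt_sin θ).neg.div
          (H.hasDerivAt_support hθ') n1.ne')).sub
          ((H.derivY θ hθ').mul (H.hasDerivAt_wronskianDeriv H₂ hθ'))
        have hd' := hd.congr_deriv (g' := wronskian X Y (fun θ => -X (-θ)) (fun θ => Y (-θ)) θ * Y θ
            / supportFn (fun θ => -X (-θ)) (fun θ => Y (-θ)) θ ^ 2) (by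
          simp only [Pi.div_apply, Pi.neg_apply]
          have e := Y_eq X Y θ
          generalize supportFn X Y θ = h1 at *
          generalize supportFn (fun θ => -X (-θ)) (fun θ => Y (-θ)) θ = h2 at *
          generalize supportDeriv X Y θ = p1 at *
          rw [e]
          field_simp
          ring)
        have hd'' := hd'.deriv
        have h5 := hWpos θ hθ
        have h6 := H.Y_pos_of_nonneg hθ.1.le hθ.2
        have : (0:ℝ) < wronskian X Y (fun θ => -X (-θ)) (fun θ => Y (-θ)) θ * Y θ
            / supportFn (fun θ => -X (-θ)) (fun θ => Y (-θ)) θ ^ 2 := by positivity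
        exact this.trans_eq hd''.symm
    have := hmono ⟨le_rfl, by linarith⟩ ⟨by linarith, le_rfl⟩ (by linarith : 0 < Real.pi / 3)
    simp only [hV0, H.wronskian_right H₂, H.right_eq] at this
    simp at this
  obtain ⟨z, hz, hz', hW⟩ := key
  exact H.eqOn_of_wronskian_eq_zero H₂ (hI ⟨hz, hz'.le⟩) hW
    (H.wronskianDeriv_eq_zero H₂ hz hz' (fun θ hθ => hX θ ⟨hz.trans hθ.1, hθ.2⟩) hW)

/-- Every arc is symmetric about the second axis. -/
theorem symm (H : IsShrinkerArc X Y) {θ : ℝ} (hθ : θ ∈ Icc (-(Real.pi / 3)) (Real.pi / 3)) :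
    X (-θ) = -X θ ∧ Y (-θ) = Y θ := by
  rcases le_total 0 (X 0) with h | h
  · have := H.symm_of_nonneg h
    have h1 := this.1 hθ
    have h2 := this.2 hθ
    simp only at h1 h2
    exact ⟨by linarith, h2.symm⟩
  · have := H.reflect.symm_of_nonneg (by simpa using h)
    have h1 := this.1 hθ
    have h2 := this.2 hθ
    simp only [neg_neg] at h1 h2
    exact ⟨by linarith, h2⟩

/-- The shrinker arc is unique. -/
theorem unique (H₁ : IsShrinkerArc X₁ Y₁) (H₂ : IsShrinkerArc X₂ Y₂) :
    EqOn X₁ X₂ (Icc (-(Real.pi / 3)) (Real.pi / 3)) ∧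
      EqOn Y₁ Y₂ (Icc (-(Real.pi / 3)) (Real.pi / 3)) := by
  have hpi := pi_pos
  have h0 : (0 : ℝ) ∈ Icc (-(Real.pi / 3)) (Real.pi / 3) := ⟨by linarith, by linarith⟩
  have hX₁ : X₁ 0 = 0 := by have := (H₁.symm h0).1; rw [neg_zero] at this; linarith
  have hX₂ : X₂ 0 = 0 := by have := (H₂.symm h0).1; rw [neg_zero] at this; linarith
  -- By symmetry both support functions have zero derivative at `0`.
  have hW : wronskian X₁ Y₁ X₂ Y₂ 0 = 0 := by simp [wronskian, supportDeriv, hX₁, hX₂]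
  exact H₁.eqOn_of_wronskian_eq_zero H₂ h0 hW (H₁.wronskianDeriv_eq_zero H₂ le_rfl (by linarith)
    (fun θ hθ => hX₁ ▸ H₁.strictMonoOn_X.monotoneOn h0 ⟨by linarith [hθ.1], hθ.2⟩ hθ.1) hW)

end IsShrinkerArc

/-! ### Existence of a shrinker arc by shooting -/

/-- The nearest point projection onto `[a, b]`. -/
noncomputable def clamp (a b x : ℝ) : ℝ := max a (min x b)

theorem clamp_mem {a b : ℝ} (hab : a ≤ b) (x : ℝ) : clamp a b x ∈ Icc a b :=
  ⟨le_max_left _ _, max_le hab (min_le_right _ _)⟩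

theorem clamp_of_mem {a b x : ℝ} (hx : x ∈ Icc a b) : clamp a b x = x := by
  rw [clamp, min_eq_left hx.2, max_eq_right hx.1]

theorem abs_clamp_sub_le (a b x y : ℝ) : |clamp a b x - clamp a b y| ≤ |x - y| := by
  have h1 := abs_max_sub_max_le_abs (min x b) (min y b) a
  have h2 := abs_min_sub_min_le_max x b y b
  rw [sub_self, abs_zero, max_eq_left (abs_nonneg _)] at h2
  rw [clamp, clamp, max_comm a, max_comm a]
  exact h1.trans h2

theorem continuous_clamp (a b : ℝ) : Continuous (clamp a b) := by
  unfold clamp; fun_prop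

/-- The right-hand side of `h'' = 1 / h - h`, modified outside `[1 / 10, 5]`. -/
noncomputable def truncForce (h : ℝ) : ℝ := 1 / clamp (1 / 10) 5 h - clamp (1 / 10) 5 h

theorem clamp_force_mem (h : ℝ) : clamp (1 / 10) 5 h ∈ Icc (1 / 10 : ℝ) 5 :=
  clamp_mem (by norm_num) h

theorem continuous_truncForce : Continuous truncForce := by
  have h := continuous_clamp (1 / 10) 5
  exact (continuous_const.div h fun x => by have := (clamp_force_mem x).1; linarith).sub h

theorem abs_truncForce_le (h : ℝ) : |truncForce h| ≤ 10 := by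
  have hc := clamp_force_mem h
  unfold truncForce
  generalize clamp (1 / 10) 5 h = c at *
  have h0 : 0 < c := by linarith [hc.1]
  have h1 : 1 / c ≤ 10 := by rw [div_le_iff₀ h0]; linarith [hc.1]
  have h2 : 0 < 1 / c := by positivity
  rw [abs_le]; constructor <;> linarith [hc.1, hc.2]

/-- The difference quotient of `1/c - c` is `-(1/(c d) + 1)`, and `c, d ≥ 1/10` bounds it by `100 +
1`. -/
theorem abs_truncForce_sub_le (x y : ℝ) : |truncForce x - truncForce y| ≤ 101 * |x - y| := by
  refine le_trans ?_ (mul_le_mul_of_nonneg_left (abs_clamp_sub_le (1 / 10) 5 x y) (by norm_num))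
  have hx := clamp_force_mem x
  have hy := clamp_force_mem y
  unfold truncForce
  generalize clamp (1 / 10) 5 x = c at *
  generalize clamp (1 / 10) 5 y = d at *
  have hc0 : 0 < c := by linarith [hx.1]
  have hd0 : 0 < d := by linarith [hy.1]
  have e : 1 / c - c - (1 / d - d) = -(1 / (c * d) + 1) * (c - d) := by field_simp; ring
  have h1 : 1 / (c * d) ≤ 100 := by
    rw [div_le_iff₀ (by positivity)]
    nlinarith [hx.1, hy.1, mul_nonneg (sub_nonneg.2 hx.1) (sub_nonneg.2 hy.1)]
  have h2 : 0 < 1 / (c * d) := by positivity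
  rw [e, abs_mul, abs_neg, abs_of_pos (by linarith)]
  exact mul_le_mul_of_nonneg_right (by linarith) (abs_nonneg _)

/-- A primitive of `truncForce`. -/
noncomputable def truncPotential (h : ℝ) : ℝ := ∫ t in (1 : ℝ)..h, truncForce t

theorem hasDerivAt_truncPotential (h : ℝ) : HasDerivAt truncPotential (truncForce h) h :=
  intervalIntegral.integral_hasDerivAt_right (continuous_truncForce.intervalIntegrable _ _)
    (continuous_truncForce.stronglyMeasurableAtFilter _ _) continuous_truncForce.continuousAt

/-- The force is positive below the rest point `1` and negative above it, so the potential has its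
maximum at `1`; together with conservation of energy this confines the orbits. -/
theorem truncPotential_strictMonoOn : StrictMonoOn truncPotential (Iic 1) := by
  apply strictMonoOn_of_deriv_pos (convex_Iic _)
    (fun x _ => (hasDerivAt_truncPotential x).continuousAt.continuousWithinAt)
  intro x hx
  rw [interior_Iic] at hx
  rw [(hasDerivAt_truncPotential x).deriv]
  have h1 : clamp (1 / 10) 5 x < 1 := max_lt (by norm_num) ((min_le_left _ _).trans_lt hx)
  have h2 := clamp_force_mem x
  unfold truncForce
  generalize clamp (1 / 10) 5 x = c at *
  have h0 : 0 < c := by linarith [h2.1]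
  have : 1 < 1 / c := by rw [lt_div_iff₀ h0]; linarith
  linarith

theorem truncPotential_strictAntiOn : StrictAntiOn truncPotential (Ici 1) := by
  apply strictAntiOn_of_deriv_neg (convex_Ici _)
    (fun x _ => (hasDerivAt_truncPotential x).continuousAt.continuousWithinAt)
  intro x hx
  rw [interior_Ici] at hx
  rw [(hasDerivAt_truncPotential x).deriv]
  have h1 : 1 < clamp (1 / 10) 5 x := lt_max_of_lt_right (lt_min hx (by norm_num))
  unfold truncForce
  generalize clamp (1 / 10) 5 x = c at *
  have h0 : 0 < c := by linarith
  have : 1 / c < 1 := by rw [div_lt_iff₀ h0]; linarith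
  linarith

/-- On `[1/10, 5]` the potential is `log h - h²/2` up to a constant, and `log 50 < 6 < (25 -
1/100)/2`. Thus orbits that start at rest in `[1/10, 1]` never exceed `5`. -/
theorem truncPotential_five_lt : truncPotential 5 < truncPotential (1 / 10) := by
  have key : ∀ x ∈ Icc (1 / 10 : ℝ) 5, HasDerivWithinAt
      (fun h => truncPotential h - (Real.log h - h ^ 2 / 2)) 0 (Icc (1 / 10) 5) x := by
    intro x hx
    have hx0 : x ≠ 0 := by linarith [hx.1]
    refine (((hasDerivAt_truncPotential x).sub ((Real.hasDerivAt_log hx0).sub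
      ((hasDerivAt_pow 2 x).div_const 2))).congr_deriv ?_).hasDerivWithinAt
    rw [truncForce, clamp_of_mem hx]
    push_cast
    ring
  have h := (convex_Icc (1 / 10 : ℝ) 5).norm_image_sub_le_of_norm_hasDerivWithin_le key
    (C := 0) (by simp) (left_mem_Icc.2 (by norm_num)) (right_mem_Icc.2 (by norm_num))
  rw [zero_mul, norm_le_zero_iff, sub_eq_zero] at h
  have h1 : Real.log 5 - Real.log (1 / 10) = Real.log 50 := by
    rw [← Real.log_div (by norm_num) (by norm_num)]; norm_num
  have h2 : Real.log 50 < 6 := by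
    have h3 : Real.log 50 ≤ Real.log (2 ^ 6) := Real.log_le_log (by norm_num) (by norm_num)
    rw [Real.log_pow] at h3
    have := Real.log_two_lt_d9
    push_cast at h3
    linarith
  norm_num at h h1
  linarith

/-- The flow of the truncated system `h' = p`, `p' = 1 / h - h`. -/
theorem exists_truncated_flow : ∃ h p : ℝ → ℝ → ℝ,
    (∀ m ∈ Icc (0 : ℝ) 1, h m 0 = m ∧ p m 0 = 0 ∧ ∀ θ ∈ Icc (-(3 / 2) : ℝ) (3 / 2),
      HasDerivWithinAt (h m) (p m θ) (Icc (-(3 / 2)) (3 / 2)) θ ∧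
      HasDerivWithinAt (p m) (truncForce (h m θ)) (Icc (-(3 / 2)) (3 / 2)) θ) ∧
    ∀ θ ∈ Icc (-(3 / 2) : ℝ) (3 / 2), ContinuousOn (fun m => h m θ) (Icc 0 1) ∧
      ContinuousOn (fun m => p m θ) (Icc 0 1) := by
  -- The time `3/2` lies between `π/3` and `π/2`. The ball of radius `1` about `(1/2, 0)` contains
  -- all starting points; with speed at most `20`, solutions move by at most `30 = 31 - 1`. The
  -- momentum is clamped to make this bound global.
  have hPL : IsPicardLindelof
      (fun (_ : ℝ) (q : ℝ × ℝ) => (clamp (-20) 20 q.2, truncForce q.1))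
      (tmin := -(3 / 2)) (tmax := 3 / 2) ⟨0, by norm_num, by norm_num⟩
      ((1 / 2 : ℝ), (0 : ℝ)) 31 1 20 101 := by
    apply IsPicardLindelof.of_time_independent
    · intro q _
      have h1 := clamp_mem (by norm_num : (-20 : ℝ) ≤ 20) q.2
      have h2 := abs_truncForce_le q.1
      rw [Prod.norm_def, Real.norm_eq_abs, Real.norm_eq_abs]
      simp only
      exact max_le (abs_le.2 (by push_cast; exact h1)) (h2.trans (by norm_num))
    · apply LipschitzWith.lipschitzOnWith
      apply LipschitzWith.of_dist_le_mul
      intro q r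
      rw [Prod.dist_eq, Prod.dist_eq, Real.dist_eq, Real.dist_eq, Real.dist_eq, Real.dist_eq]
      simp only
      have h1 := abs_clamp_sub_le (-20) 20 q.2 r.2
      have h2 := abs_truncForce_sub_le q.1 r.1
      have h3 := le_max_left |q.1 - r.1| |q.2 - r.2|
      have h4 := le_max_right |q.1 - r.1| |q.2 - r.2|
      have h5 := abs_nonneg (q.2 - r.2)
      push_cast
      exact max_le (by linarith) (by linarith)
    · norm_num
  obtain ⟨α, hα, L', hL'⟩ :=
    hPL.exists_forall_mem_closedBall_eq_hasDerivWithinAt_lipschitzOnWith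
  have hmem : ∀ m ∈ Icc (0 : ℝ) 1,
      ((m, 0) : ℝ × ℝ) ∈ Metric.closedBall ((1 / 2 : ℝ), (0 : ℝ)) ((1 : NNReal) : ℝ) := by
    intro m hm
    rw [Metric.mem_closedBall, Prod.dist_eq, Real.dist_eq, Real.dist_eq]
    simp only [sub_self, abs_zero, NNReal.coe_one]
    exact max_le (abs_le.2 ⟨by linarith [hm.1], by linarith [hm.2]⟩) (by norm_num)
  refine ⟨fun m θ => (α (m, 0) θ).1, fun m θ => (α (m, 0) θ).2, ?_, ?_⟩
  · intro m hm
    obtain ⟨h0, hd⟩ := hα _ (hmem m hm)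
    simp only at h0
    have hp : ∀ θ ∈ Icc (-(3 / 2) : ℝ) (3 / 2), HasDerivWithinAt (fun θ => (α (m, 0) θ).2)
        (truncForce (α (m, 0) θ).1) (Icc (-(3 / 2)) (3 / 2)) θ := fun θ hθ => (hd θ hθ).snd
    refine ⟨by simp [h0], by simp [h0], fun θ hθ => ⟨?_, hp θ hθ⟩⟩
    -- Since `|p'| ≤ 10`, one has `|p| ≤ 15` up to time `3/2`, so the clamp at `20` is never active.
    have hbd := (convex_Icc (-(3 / 2) : ℝ) (3 / 2)).norm_image_sub_le_of_norm_hasDerivWithin_le hp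
      (C := 10) (fun θ _ => abs_truncForce_le _) ⟨by norm_num, by norm_num⟩ hθ (x := 0)
    rw [Real.norm_eq_abs, Real.norm_eq_abs, h0] at hbd
    simp only [sub_zero] at hbd
    have h3 : |θ| ≤ 3 / 2 := abs_le.2 hθ
    have := (hd θ hθ).fst
    rwa [clamp_of_mem (abs_le.1 (by linarith : |(α (m, 0) θ).2| ≤ 20))] at this
  · intro θ hθ
    have h1 : ContinuousOn (fun m : ℝ => α (m, 0) θ) (Icc 0 1) :=
      (hL' θ hθ).continuousOn.comp (by fun_prop) hmem
    exact ⟨continuous_fst.comp_continuousOn h1, continuous_snd.comp_continuousOn h1⟩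

/-- A priori bounds and the energy identity for the truncated flow. -/
theorem truncated_flow_bounds {h p : ℝ → ℝ} {m : ℝ} (hm : m ∈ Icc (1 / 10 : ℝ) 1)
    (h0 : h 0 = m) (p0 : p 0 = 0)
    (hd : ∀ θ ∈ Icc (-(3 / 2) : ℝ) (3 / 2),
      HasDerivWithinAt h (p θ) (Icc (-(3 / 2)) (3 / 2)) θ ∧
      HasDerivWithinAt p (truncForce (h θ)) (Icc (-(3 / 2)) (3 / 2)) θ)
    {θ : ℝ} (hθ : θ ∈ Icc (-(3 / 2) : ℝ) (3 / 2)) :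
    m ≤ h θ ∧ h θ ≤ 5 ∧ p θ ^ 2 = 2 * (truncPotential (h θ) - truncPotential m) := by
  have key : ∀ x ∈ Icc (-(3 / 2) : ℝ) (3 / 2), HasDerivWithinAt
      (fun θ => p θ ^ 2 - 2 * truncPotential (h θ)) 0 (Icc (-(3 / 2)) (3 / 2)) x := by
    intro x hx
    obtain ⟨h1, h2⟩ := hd x hx
    refine ((h2.pow 2).sub
      (((hasDerivAt_truncPotential (h x)).comp_hasDerivWithinAt x h1).const_mul 2)).congr_deriv ?_
    push_cast
    ring
  have he := (convex_Icc (-(3 / 2) : ℝ) (3 / 2)).norm_image_sub_le_of_norm_hasDerivWithin_le key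
    (C := 0) (by simp) (x := 0) ⟨by norm_num, by norm_num⟩ hθ
  rw [zero_mul, norm_le_zero_iff, sub_eq_zero] at he
  simp only [h0, p0] at he
  have hE : p θ ^ 2 = 2 * (truncPotential (h θ) - truncPotential m) := by linarith
  have hnn := sq_nonneg (p θ)
  -- As `p² ≥ 0`, the potential along the orbit is at least its value at `m`; it is smaller than
  -- that below `m` and above `5`.
  refine ⟨?_, ?_, hE⟩
  · by_contra! hlt
    have := truncPotential_strictMonoOn (hlt.le.trans hm.2 : h θ ≤ 1) hm.2 hlt
    linarith
  · by_contra! hlt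
    have h1 := truncPotential_strictAntiOn (by norm_num : (1 : ℝ) ≤ 5)
      (by linarith : (1 : ℝ) ≤ h θ) hlt
    have h2 := truncPotential_five_lt
    have h3 := truncPotential_strictMonoOn.monotoneOn (by norm_num : (1 / 10 : ℝ) ≤ 1) hm.2 hm.1
    linarith

/-- Shooting: an even solution of `h'' = 1 / h - h` satisfying the boundary condition at `π / 3`. -/
theorem exists_shooting_solution : ∃ h p : ℝ → ℝ, p 0 = 0 ∧
    (∀ θ ∈ Ioo (-(3 / 2) : ℝ) (3 / 2), 0 < h θ ∧ HasDerivAt h (p θ) θ ∧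
      HasDerivAt p (1 / h θ - h θ) θ) ∧
    h (Real.pi / 3) * Real.cos (Real.pi / 3) - p (Real.pi / 3) * Real.sin (Real.pi / 3) = 0 := by
  obtain ⟨h, p, hflow, hcont⟩ := exists_truncated_flow
  have hsub : Icc (1 / 10 : ℝ) 1 ⊆ Icc 0 1 := Icc_subset_Icc_left (by norm_num)
  have hpi : Real.pi / 3 ∈ Icc (-(3 / 2) : ℝ) (3 / 2) :=
    ⟨by linarith [Real.pi_pos], by linarith [Real.pi_lt_d2]⟩
  have hb : ∀ m ∈ Icc (1 / 10 : ℝ) 1, ∀ θ ∈ Icc (-(3 / 2) : ℝ) (3 / 2),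
      m ≤ h m θ ∧ h m θ ≤ 5 ∧ p m θ ^ 2 = 2 * (truncPotential (h m θ) - truncPotential m) :=
    fun m hm θ hθ => by
      obtain ⟨h0, p0, hd⟩ := hflow m (hsub hm)
      exact truncated_flow_bounds hm h0 p0 hd hθ
  have hd : ∀ m ∈ Icc (1 / 10 : ℝ) 1, ∀ θ ∈ Ioo (-(3 / 2) : ℝ) (3 / 2), 0 < h m θ ∧
      HasDerivAt (h m) (p m θ) θ ∧ HasDerivAt (p m) (1 / h m θ - h m θ) θ := by
    intro m hm θ hθ
    obtain ⟨h1, h2, -⟩ := hb m hm θ (Ioo_subset_Icc_self hθ)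
    obtain ⟨d1, d2⟩ := (hflow m (hsub hm)).2.2 θ (Ioo_subset_Icc_self hθ)
    have hn := Icc_mem_nhds hθ.1 hθ.2
    have d2' := d2.hasDerivAt hn
    rw [truncForce, clamp_of_mem ⟨hm.1.trans h1, h2⟩] at d2'
    exact ⟨by linarith [hm.1], d1.hasDerivAt hn, d2'⟩
  -- `g m` is the height `Y` at `θ = π/3` of the arc that starts with `h(0) = m`.
  set g : ℝ → ℝ := fun m => h m (Real.pi / 3) * Real.cos (Real.pi / 3)
    - p m (Real.pi / 3) * Real.sin (Real.pi / 3) with hg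
  have gcont : ContinuousOn g (Icc (1 / 10) 1) :=
    ((((hcont _ hpi).1.mul continuousOn_const).sub ((hcont _ hpi).2.mul continuousOn_const))).mono
      hsub
  -- For `m = 1` the energy identity forces the rest solution `h = 1`, with `g 1 = cos(π/3)`.
  have g1 : 0 ≤ g 1 := by
    obtain ⟨h1, h2, h3⟩ := hb 1 ⟨by norm_num, le_rfl⟩ _ hpi
    have h4 : h 1 (Real.pi / 3) = 1 := by
      by_contra hne
      have := truncPotential_strictAntiOn (le_refl (1 : ℝ)) h1 (lt_of_le_of_ne h1 (Ne.symm hne))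
      nlinarith [sq_nonneg (p 1 (Real.pi / 3))]
    rw [h4, sub_self, mul_zero] at h3
    have h5 : p 1 (Real.pi / 3) = 0 := by nlinarith
    simp only [hg, h4, h5, Real.cos_pi_div_three]
    norm_num
  -- From `h ≤ 5` one gets `Y' = -sin θ / h ≤ -sin θ / 5`, so `Y - cos θ / 5` is nonincreasing.
  -- Hence `Y(π/3) ≤ 1/10 - 1/5 + 1/10 = 0`, which explains the choice of `1/10` and `5`.
  have g0 : g (1 / 10) ≤ 0 := by
    have hm : (1 / 10 : ℝ) ∈ Icc (1 / 10 : ℝ) 1 := ⟨le_rfl, by norm_num⟩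
    obtain ⟨e1, e2, -⟩ := hflow _ (hsub hm)
    have hI : ∀ θ ∈ Icc 0 (Real.pi / 3), θ ∈ Ioo (-(3 / 2) : ℝ) (3 / 2) := fun θ hθ =>
      ⟨by linarith [hθ.1], by linarith [hθ.2, Real.pi_lt_d2]⟩
    have hder : ∀ θ ∈ Icc 0 (Real.pi / 3), HasDerivAt
        (fun θ => h (1 / 10) θ * Real.cos θ - p (1 / 10) θ * Real.sin θ - Real.cos θ / 5)
        (-Real.sin θ / h (1 / 10) θ + Real.sin θ / 5) θ := by
      intro θ hθ
      obtain ⟨f1, f2, f3⟩ := hd _ hm θ (hI θ hθ)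
      exact (((f2.mul (Real.hasDerivAt_cos θ)).sub (f3.mul (Real.hasDerivAt_sin θ))).sub
        ((Real.hasDerivAt_cos θ).div_const 5)).congr_deriv (by ring)
    have hanti : AntitoneOn
        (fun θ => h (1 / 10) θ * Real.cos θ - p (1 / 10) θ * Real.sin θ - Real.cos θ / 5)
        (Icc 0 (Real.pi / 3)) := by
      apply antitoneOn_of_deriv_nonpos (convex_Icc _ _)
      · exact fun θ hθ => (hder θ hθ).continuousAt.continuousWithinAt
      · intro θ hθ
        rw [interior_Icc] at hθ
        exact (hder θ (Ioo_subset_Icc_self hθ)).differentiableAt.differentiableWithinAt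
      · intro θ hθ
        rw [interior_Icc] at hθ
        have hθ' := Ioo_subset_Icc_self hθ
        rw [(hder θ hθ').deriv]
        have b1 := (hd _ hm θ (hI θ hθ')).1
        have b2 := (hb _ hm θ (Ioo_subset_Icc_self (hI θ hθ'))).2.1
        have b3 : 0 < Real.sin θ := Real.sin_pos_of_pos_of_lt_pi hθ.1
          (by linarith [hθ.2, Real.pi_pos])
        have : Real.sin θ / 5 ≤ Real.sin θ / h (1 / 10) θ :=
          div_le_div_of_nonneg_left b3.le b1 b2
        rw [neg_div]
        linarith
    have h0 : (0 : ℝ) ≤ Real.pi / 3 := by positivity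
    have := hanti (left_mem_Icc.2 h0) (right_mem_Icc.2 h0) h0
    simp only [e1, e2, Real.cos_zero, Real.sin_zero] at this
    have hc := Real.cos_pi_div_three
    simp only [hg]
    linarith
  obtain ⟨m, hm, hgm⟩ := intermediate_value_Icc (by norm_num : (1 / 10 : ℝ) ≤ 1) gcont ⟨g0, g1⟩
  exact ⟨h m, p m, (hflow m (hsub hm)).2.1, hd m hm, hgm⟩

/-- There is a shrinker arc, defined beyond its end points. -/
theorem exists_shrinkerArc : ∃ X Y : ℝ → ℝ, IsShrinkerArc X Y ∧
    ∀ θ ∈ Ioo (-(3 / 2) : ℝ) (3 / 2), 0 < supportFn X Y θ ∧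
      HasDerivAt X (Real.cos θ / supportFn X Y θ) θ ∧
      HasDerivAt Y (-Real.sin θ / supportFn X Y θ) θ := by
  obtain ⟨h, p, p0, hd, hbc⟩ := exists_shooting_solution
  set X : ℝ → ℝ := fun θ => h θ * Real.sin θ + p θ * Real.cos θ with hX
  set Y : ℝ → ℝ := fun θ => h θ * Real.cos θ - p θ * Real.sin θ with hY
  have hs : ∀ θ, supportFn X Y θ = h θ := by
    intro θ
    simp only [supportFn, hX, hY]
    linear_combination h θ * Real.sin_sq_add_cos_sq θ
  have hI : Icc (-(Real.pi / 3)) (Real.pi / 3) ⊆ Ioo (-(3 / 2) : ℝ) (3 / 2) :=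
    fun θ hθ => ⟨by linarith [hθ.1, Real.pi_lt_d2], by linarith [hθ.2, Real.pi_lt_d2]⟩
  have key : ∀ θ ∈ Ioo (-(3 / 2) : ℝ) (3 / 2), 0 < supportFn X Y θ ∧
      HasDerivAt X (Real.cos θ / supportFn X Y θ) θ ∧
      HasDerivAt Y (-Real.sin θ / supportFn X Y θ) θ := by
    intro θ hθ
    obtain ⟨h1, h2, h3⟩ := hd θ hθ
    rw [hs]
    refine ⟨h1, ?_, ?_⟩
    · exact ((h2.mul (Real.hasDerivAt_sin θ)).add (h3.mul (Real.hasDerivAt_cos θ))).congr_deriv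
        (by ring)
    · exact ((h2.mul (Real.hasDerivAt_cos θ)).sub (h3.mul (Real.hasDerivAt_sin θ))).congr_deriv
        (by ring)
  have hneg : ∀ θ ∈ Ioo (-(3 / 2) : ℝ) (3 / 2), -θ ∈ Ioo (-(3 / 2) : ℝ) (3 / 2) :=
    fun θ hθ => ⟨by linarith [hθ.2], by linarith [hθ.1]⟩
  -- Shooting secures only the condition at `π/3`. Evenness of `h` transfers it to `-π/3`; it
  -- follows from linear uniqueness for the difference of `h` and its reflection, whose data at `0`
  -- vanish.
  have hev : ∀ θ ∈ Icc (-(Real.pi / 3)) (Real.pi / 3), h θ - h (-θ) = 0 ∧ p θ + p (-θ) = 0 := by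
    have dW : ∀ θ ∈ Ioo (-(3 / 2) : ℝ) (3 / 2),
        HasDerivAt (fun θ => h θ - h (-θ)) (p θ + p (-θ)) θ := fun θ hθ =>
      ((hd θ hθ).2.1.sub ((hd _ (hneg θ hθ)).2.1.scomp θ (hasDerivAt_neg θ))).congr_deriv
        (by simp)
    have dV : ∀ θ ∈ Ioo (-(3 / 2) : ℝ) (3 / 2), HasDerivAt (fun θ => p θ + p (-θ))
        (-(1 / (h θ * h (-θ)) + 1) * (h θ - h (-θ))) θ := fun θ hθ =>
      ((hd θ hθ).2.2.add ((hd _ (hneg θ hθ)).2.2.scomp θ (hasDerivAt_neg θ))).congr_deriv (by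
        have h1 := (hd θ hθ).1
        have h2 := (hd _ (hneg θ hθ)).1
        simp only [smul_eq_mul]
        field_simp
        ring)
    have ch : ContinuousOn h (Icc (-(Real.pi / 3)) (Real.pi / 3)) := fun θ hθ =>
      (hd θ (hI hθ)).2.1.continuousAt.continuousWithinAt
    have ch' : ContinuousOn (fun θ => h (-θ)) (Icc (-(Real.pi / 3)) (Real.pi / 3)) :=
      ch.comp continuous_neg.continuousOn
        fun θ hθ => ⟨by linarith [hθ.2], by linarith [hθ.1]⟩
    refine linear_system_eq_zero (k := fun θ => 1 / (h θ * h (-θ)) + 1) (z := 0)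
      (fun θ hθ => (dW θ (hI hθ)).continuousAt.continuousWithinAt)
      (fun θ hθ => (dV θ (hI hθ)).continuousAt.continuousWithinAt)
      ((continuousOn_const.div (ch.mul ch') fun θ hθ =>
        (mul_pos (hd θ (hI hθ)).1 (hd _ (hneg θ (hI hθ))).1).ne').add continuousOn_const)
      (fun θ hθ => dW θ (hI (Ioo_subset_Icc_self hθ)))
      (fun θ hθ => dV θ (hI (Ioo_subset_Icc_self hθ)))
      ⟨by linarith [Real.pi_pos], by linarith [Real.pi_pos]⟩ (by simp) (by simp [p0])
  refine ⟨X, Y, ⟨fun θ hθ => (key θ (hI hθ)).2.1.continuousAt.continuousWithinAt,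
    fun θ hθ => (key θ (hI hθ)).2.2.continuousAt.continuousWithinAt,
    fun θ hθ => (key θ (hI (Ioo_subset_Icc_self hθ))).2.1,
    fun θ hθ => (key θ (hI (Ioo_subset_Icc_self hθ))).2.2,
    fun θ hθ => (key θ (hI hθ)).1, ?_, hbc⟩, key⟩
  obtain ⟨h1, h2⟩ := hev (Real.pi / 3) ⟨by linarith [Real.pi_pos], le_rfl⟩
  simp only [hY, Real.cos_neg, Real.sin_neg]
  have h3 : h (-(Real.pi / 3)) = h (Real.pi / 3) := by linarith
  have h4 : p (-(Real.pi / 3)) = -p (Real.pi / 3) := by linarith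
  rw [h3, h4]
  linarith

/-! ### Passing between graphs, curves and the normal angle -/

/-- A left inverse of a continuous function on a compact set is continuous on the image. -/
theorem continuousOn_of_leftInvOn_of_isCompact {α β : Type*} [TopologicalSpace α]
    [TopologicalSpace β] [T2Space β] {f : α → β} {g : β → α} {K : Set α} (hK : IsCompact K)
    (hf : ContinuousOn f K) (hg : LeftInvOn g f K) : ContinuousOn g (f '' K) := by
  rw [continuousOn_iff_isClosed]
  intro t ht
  refine ⟨f '' (K ∩ t), ((hK.inter_right ht).image_of_continuousOn
    (hf.mono inter_subset_left)).isClosed, ?_⟩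
  ext y
  constructor
  · rintro ⟨h1, x, hx, rfl⟩
    refine ⟨⟨x, ⟨hx, ?_⟩, rfl⟩, x, hx, rfl⟩
    rwa [mem_preimage, hg hx] at h1
  · rintro ⟨⟨x, ⟨hx, hxt⟩, rfl⟩, h2⟩
    exact ⟨by rwa [mem_preimage, hg hx], h2⟩

/-- The inverse of a strictly increasing continuous function on a compact interval. -/
theorem exists_inverse_of_strictMonoOn {f : ℝ → ℝ} {a b : ℝ} (hab : a < b)
    (hf : ContinuousOn f (Icc a b)) (hmono : StrictMonoOn f (Icc a b)) :
    ∃ g : ℝ → ℝ, ContinuousOn g (Icc (f a) (f b)) ∧ (∀ x ∈ Icc a b, g (f x) = x) ∧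
      (∀ y ∈ Icc (f a) (f b), g y ∈ Icc a b ∧ f (g y) = y) ∧
      (∀ y ∈ Ioo (f a) (f b), g y ∈ Ioo a b) ∧
      ∀ y ∈ Ioo (f a) (f b), ∀ c, HasDerivAt f c (g y) → c ≠ 0 → HasDerivAt g c⁻¹ y := by
  have hL : LeftInvOn (Function.invFunOn f (Icc a b)) f (Icc a b) := hmono.injOn.leftInvOn_invFunOn
  have himg : f '' Icc a b = Icc (f a) (f b) := by
    apply Subset.antisymm
    · rintro _ ⟨x, hx, rfl⟩
      exact ⟨hmono.monotoneOn (left_mem_Icc.2 hab.le) hx hx.1,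
        hmono.monotoneOn hx (right_mem_Icc.2 hab.le) hx.2⟩
    · exact intermediate_value_Icc hab.le hf
  set g := Function.invFunOn f (Icc a b)
  have hg : ContinuousOn g (Icc (f a) (f b)) :=
    himg ▸ continuousOn_of_leftInvOn_of_isCompact isCompact_Icc hf hL
  have hR : ∀ y ∈ Icc (f a) (f b), g y ∈ Icc a b ∧ f (g y) = y := by
    intro y hy
    rw [← himg] at hy
    obtain ⟨x, hx, rfl⟩ := hy
    rw [hL hx]
    exact ⟨hx, rfl⟩
  refine ⟨g, hg, fun x hx => hL hx, hR, ?_, ?_⟩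
  · intro y hy
    obtain ⟨h1, h2⟩ := hR y (Ioo_subset_Icc_self hy)
    refine ⟨h1.1.lt_of_ne ?_, h1.2.lt_of_ne ?_⟩
    · intro h
      rw [← h] at h2
      exact hy.1.ne h2
    · intro h
      rw [h] at h2
      exact hy.2.ne h2.symm
  · intro y hy c hc hc0
    exact hc.of_local_left_inverse ((hg y (Ioo_subset_Icc_self hy)).continuousAt
      (Icc_mem_nhds hy.1 hy.2)) hc0 (by
        filter_upwards [Icc_mem_nhds hy.1 hy.2] with z hz using (hR z hz).2)

/-- A shrinking curve with strictly increasing normal angle `ϑ` can be parametrized by that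
angle. -/
theorem exists_shrinkerArc_of_curve {x y ϑ l : ℝ → ℝ} {α β : ℝ} (hαβ : α < β)
    (cx : ContinuousOn x (Icc α β)) (cy : ContinuousOn y (Icc α β))
    (cϑ : ContinuousOn ϑ (Icc α β))
    (dx : ∀ s ∈ Ioo α β, HasDerivAt x (l s * Real.cos (ϑ s)) s)
    (dy : ∀ s ∈ Ioo α β, HasDerivAt y (-(l s * Real.sin (ϑ s))) s)
    (dϑ : ∀ s ∈ Ioo α β,
      HasDerivAt ϑ (l s * (x s * Real.sin (ϑ s) + y s * Real.cos (ϑ s))) s)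
    (hl : ∀ s ∈ Ioo α β, 0 < l s)
    (hpos : ∀ s ∈ Icc α β, 0 < x s * Real.sin (ϑ s) + y s * Real.cos (ϑ s))
    (hα : ϑ α = -(Real.pi / 3)) (hβ : ϑ β = Real.pi / 3) (yα : y α = 0) (yβ : y β = 0) :
    ∃ X Y : ℝ → ℝ, IsShrinkerArc X Y ∧
      (∀ s ∈ Icc α β, ϑ s ∈ Icc (-(Real.pi / 3)) (Real.pi / 3) ∧ X (ϑ s) = x s ∧ Y (ϑ s) = y s) ∧
      ∀ θ ∈ Icc (-(Real.pi / 3)) (Real.pi / 3), ∃ s ∈ Icc α β, ϑ s = θ := by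
  have hmono : StrictMonoOn ϑ (Icc α β) := by
    apply strictMonoOn_of_deriv_pos (convex_Icc _ _) cϑ
    intro s hs
    rw [interior_Icc] at hs
    rw [(dϑ s hs).deriv]
    exact mul_pos (hl s hs) (hpos s (Ioo_subset_Icc_self hs))
  obtain ⟨g, cg, gl, gr, go, gd⟩ := exists_inverse_of_strictMonoOn hαβ cϑ hmono
  rw [hα, hβ] at cg gr go gd
  have hs : ∀ θ ∈ Icc (-(Real.pi / 3)) (Real.pi / 3), supportFn (x ∘ g) (y ∘ g) θ
      = x (g θ) * Real.sin (ϑ (g θ)) + y (g θ) * Real.cos (ϑ (g θ)) := by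
    intro θ hθ
    simp only [supportFn, Function.comp]
    rw [(gr θ hθ).2]
  have dg : ∀ θ ∈ Ioo (-(Real.pi / 3)) (Real.pi / 3),
      HasDerivAt g (l (g θ) * supportFn (x ∘ g) (y ∘ g) θ)⁻¹ θ := by
    intro θ hθ
    rw [hs θ (Ioo_subset_Icc_self hθ)]
    exact gd θ hθ _ (dϑ _ (go θ hθ)) (mul_pos (hl _ (go θ hθ))
      (hpos _ (Ioo_subset_Icc_self (go θ hθ)))).ne'
  refine ⟨x ∘ g, y ∘ g, ⟨cx.comp cg fun θ hθ => (gr θ hθ).1, cy.comp cg fun θ hθ => (gr θ hθ).1,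
    ?_, ?_, ?_, ?_, ?_⟩, ?_, fun θ hθ => ⟨g θ, gr θ hθ⟩⟩
  · intro θ hθ
    refine ((dx _ (go θ hθ)).comp θ (dg θ hθ)).congr_deriv ?_
    have h1 := (hl _ (go θ hθ)).ne'
    rw [(gr θ (Ioo_subset_Icc_self hθ)).2]
    field_simp
  · intro θ hθ
    refine ((dy _ (go θ hθ)).comp θ (dg θ hθ)).congr_deriv ?_
    have h1 := (hl _ (go θ hθ)).ne'
    rw [(gr θ (Ioo_subset_Icc_self hθ)).2]
    field_simp
  · intro θ hθ
    rw [hs θ hθ]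
    exact hpos _ (gr θ hθ).1
  · rw [← hα, Function.comp_apply, gl α (left_mem_Icc.2 hαβ.le), yα]
  · rw [← hβ, Function.comp_apply, gl β (right_mem_Icc.2 hαβ.le), yβ]
  · intro s hs
    refine ⟨?_, by simp [gl s hs], by simp [gl s hs]⟩
    rw [← hα, ← hβ]
    exact ⟨hmono.monotoneOn (left_mem_Icc.2 hαβ.le) hs hs.1,
      hmono.monotoneOn hs (right_mem_Icc.2 hαβ.le) hs.2⟩

/-- The derivatives of a self-similar profile. -/
theorem IsSelfSimilarProfile.hasDerivAt {a b : ℝ} {v : ℝ → ℝ} (H : IsSelfSimilarProfile a b v) :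
    ContinuousOn (derivWithin v (Icc a b)) (Icc a b) ∧ ∀ x ∈ Ioo a b,
      HasDerivAt v (derivWithin v (Icc a b) x) x ∧
      HasDerivAt (derivWithin v (Icc a b)) ((1 + derivWithin v (Icc a b) x ^ 2)
        * (x * derivWithin v (Icc a b) x - v x)) x := by
  have hu := uniqueDiffOn_Icc H.lt
  have h2 : ContDiffOn ℝ (1 + 1) v (Icc a b) := by
    have := H.contDiffOn
    rwa [show (2 : WithTop ℕ∞) = 1 + 1 from (one_add_one_eq_two).symm] at this
  obtain ⟨hd, -, hD⟩ := (contDiffOn_succ_iff_derivWithin hu).1 h2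
  refine ⟨hD.continuousOn, fun x hx => ?_⟩
  have hn : Icc a b ∈ 𝓝 x := Icc_mem_nhds hx.1 hx.2
  have hv := (hd x (Ioo_subset_Icc_self hx)).hasDerivWithinAt.hasDerivAt hn
  refine ⟨hv, ?_⟩
  have hD' := ((hD.differentiableOn one_ne_zero) x (Ioo_subset_Icc_self hx)).differentiableAt hn
  have he : derivWithin v (Icc a b) =ᶠ[𝓝 x] deriv v := by
    filter_upwards [isOpen_Ioo.mem_nhds hx] with z hz
    exact derivWithin_of_mem_nhds (Icc_mem_nhds hz.1 hz.2)
  refine hD'.hasDerivAt.congr_deriv ?_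
  rw [he.deriv_eq, H.ode x hx, he.eq_of_nhds]

/-- A graph of slope `d` has normal angle `-arctan d` and speed `√(1 + d²)`; these are the
components of its tangent `(1, d)` in that notation. -/
theorem sqrt_mul_cos_sin_neg_arctan (d : ℝ) :
    √(1 + d ^ 2) * Real.cos (-Real.arctan d) = 1 ∧ √(1 + d ^ 2) * Real.sin (-Real.arctan d) = -d := by
  have h : 0 < √(1 + d ^ 2) := Real.sqrt_pos.2 (by positivity)
  rw [Real.cos_neg, Real.sin_neg, Real.cos_arctan, Real.sin_arctan]
  constructor <;> field_simp

/-- A self-similar profile is the graph of a shrinker arc. -/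
theorem IsSelfSimilarProfile.exists_shrinkerArc {a b : ℝ} {v : ℝ → ℝ}
    (H : IsSelfSimilarProfile a b v) : ∃ X Y : ℝ → ℝ, IsShrinkerArc X Y ∧
      X (-(Real.pi / 3)) = a ∧ X (Real.pi / 3) = b ∧
      (∀ x ∈ Icc a b, ∃ θ ∈ Icc (-(Real.pi / 3)) (Real.pi / 3), X θ = x) ∧
      ∀ θ ∈ Icc (-(Real.pi / 3)) (Real.pi / 3), v (X θ) = Y θ := by
  obtain ⟨cD, hd⟩ := H.hasDerivAt
  have hab := H.lt
  have hsa := H.left_slope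
  have hsb := H.right_slope
  have cv := H.contDiffOn.continuousOn
  set D := derivWithin v (Icc a b)
  have cf : ContinuousOn (fun x => x * D x - v x) (Icc a b) := (continuousOn_id.mul cD).sub cv
  -- `x v' - v` is minus the speed times the support function. It solves a linear first order
  -- equation, hence has no zero unless it vanishes identically; at a critical point of `v` it
  -- equals `-v < 0`.
  have df : ∀ x ∈ Ioo a b, HasDerivAt (fun x => x * D x - v x)
      (x * (1 + D x ^ 2) * (x * D x - v x)) x := fun x hx =>
    (((hasDerivAt_id' x).mul (hd x hx).2).sub (hd x hx).1).congr_deriv (by ring)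
  obtain ⟨c, hc, hc'⟩ := exists_hasDerivAt_eq_zero hab cv (H.left_eq.trans H.right_eq.symm)
    fun x hx => (hd x hx).1
  have hfc : c * D c - v c < 0 := by
    rw [hc', mul_zero, zero_sub]
    exact neg_lt_zero.2 (H.pos c hc)
  have hne : ∀ x ∈ Icc a b, x * D x - v x ≠ 0 := by
    intro z hz h0
    obtain ⟨K, hK⟩ := isCompact_Icc.exists_bound_of_continuousOn
      (continuousOn_id.mul (continuousOn_const.add (cD.pow 2)) :
        ContinuousOn (fun x => x * (1 + D x ^ 2)) (Icc a b))
    have := eq_zero_of_abs_deriv_le (G := fun x => (x * D x - v x) ^ 2)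
      (G' := fun x => 2 * (x * (1 + D x ^ 2)) * (x * D x - v x) ^ 2) (C := 2 * K) (cf.pow 2)
      (fun x hx => ((df x hx).pow 2).congr_deriv (by push_cast; ring))
      (fun x _ => sq_nonneg _) (fun x hx => by
        have := hK x (Ioo_subset_Icc_self hx)
        rw [abs_mul, abs_mul, abs_of_pos (two_pos : (0 : ℝ) < 2),
          abs_of_nonneg (sq_nonneg (x * D x - v x))]
        exact mul_le_mul_of_nonneg_right (by simpa using this) (sq_nonneg _))
      hz (by simp [h0]) c (Ioo_subset_Icc_self hc)
    exact hfc.ne (by simpa using this)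
  have hneg : ∀ x ∈ Icc a b, x * D x - v x < 0 := by
    intro x hx
    by_contra hge
    rw [not_lt] at hge
    obtain ⟨z, hz, hz'⟩ := isPreconnected_Icc.intermediate_value (Ioo_subset_Icc_self hc) hx cf
      ⟨hfc.le, hge⟩
    exact hne z hz hz'
  have hl : ∀ x, 0 < √(1 + D x ^ 2) := fun x => Real.sqrt_pos.2 (by positivity)
  have hh : ∀ x, √(1 + D x ^ 2) * (x * Real.sin (-Real.arctan (D x))
      + v x * Real.cos (-Real.arctan (D x))) = -(x * D x - v x) := by
    intro x
    obtain ⟨h1, h2⟩ := sqrt_mul_cos_sin_neg_arctan (D x)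
    linear_combination v x * h1 + x * h2
  have h3 : Real.arctan (√3) = Real.pi / 3 := by
    rw [← Real.tan_pi_div_three]
    exact Real.arctan_tan (by linarith [Real.pi_pos]) (by linarith [Real.pi_pos])
  obtain ⟨X, Y, hXY, h1, h2⟩ := exists_shrinkerArc_of_curve (x := fun x => x) (y := v)
    (ϑ := fun x => -Real.arctan (D x)) (l := fun x => √(1 + D x ^ 2)) hab continuousOn_id cv
    (Real.continuous_arctan.comp_continuousOn cD).neg
    (fun x _ => (hasDerivAt_id' x).congr_deriv (sqrt_mul_cos_sin_neg_arctan (D x)).1.symm)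
    (fun x hx => (hd x hx).1.congr_deriv (by rw [(sqrt_mul_cos_sin_neg_arctan (D x)).2, neg_neg]))
    (fun x hx => by
      rw [hh]
      refine (hd x hx).2.arctan.neg.congr_deriv ?_
      have : (1 : ℝ) + D x ^ 2 ≠ 0 := by positivity
      field_simp)
    (fun x _ => hl x)
    (fun x hx => by
      have := hneg x hx
      have h4 := hh x
      have h5 := hl x
      by_contra hle
      nlinarith [mul_nonneg h5.le (neg_nonneg.2 (not_lt.1 hle))])
    (by rw [hsa, h3]) (by rw [hsb, Real.arctan_neg, h3, neg_neg])
    H.left_eq H.right_eq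
  refine ⟨X, Y, hXY, ?_, ?_, ?_, ?_⟩
  · have := (h1 a (left_mem_Icc.2 hab.le)).2.1
    rwa [hsa, h3] at this
  · have := (h1 b (right_mem_Icc.2 hab.le)).2.1
    rwa [hsb, Real.arctan_neg, h3, neg_neg] at this
  · exact fun x hx => ⟨_, (h1 x hx).1, (h1 x hx).2.1⟩
  · intro θ hθ
    obtain ⟨s, hs, rfl⟩ := h2 θ hθ
    rw [(h1 s hs).2.1, (h1 s hs).2.2]

/-- A shrinker arc that extends beyond its end points is the graph of a function solving the
profile equation on a neighbourhood of `[-b, b]`. -/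
theorem exists_graph_of_shrinkerArc {X Y : ℝ → ℝ} (H : IsShrinkerArc X Y)
    (hext : ∀ θ ∈ Ioo (-(3 / 2) : ℝ) (3 / 2), 0 < supportFn X Y θ ∧
      HasDerivAt X (Real.cos θ / supportFn X Y θ) θ ∧
      HasDerivAt Y (-Real.sin θ / supportFn X Y θ) θ) :
    ∃ (b c₀ c₁ : ℝ) (u u₁ : ℝ → ℝ), 0 < b ∧ c₀ < -b ∧ b < c₁ ∧ X (Real.pi / 3) = b ∧
      (∀ x ∈ Ioo c₀ c₁, HasDerivAt u (u₁ x) x ∧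
        HasDerivAt u₁ ((1 + u₁ x ^ 2) * (x * u₁ x - u x)) x) ∧
      (∀ θ ∈ Icc (-(Real.pi / 3)) (Real.pi / 3), u (X θ) = Y θ ∧ u₁ (X θ) = -Real.tan θ) ∧
      ∀ x ∈ Icc (-b) b, ∃ θ ∈ Icc (-(Real.pi / 3)) (Real.pi / 3), X θ = x := by
  have hpi := Real.pi_pos
  have hpi' := Real.pi_lt_d2
  -- The angle `6/5` lies strictly between `π/3` and `3/2`, so the graph continues past both end
  -- points. This gives smoothness of `u` up to the boundary.
  have hI : Icc (-(6 / 5) : ℝ) (6 / 5) ⊆ Ioo (-(3 / 2)) (3 / 2) := fun θ hθ =>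
    ⟨by linarith [hθ.1], by linarith [hθ.2]⟩
  have hcos : ∀ θ ∈ Ioo (-(3 / 2) : ℝ) (3 / 2), 0 < Real.cos θ := fun θ hθ =>
    Real.cos_pos_of_mem_Ioo
      ⟨by linarith [hθ.1, Real.pi_gt_three], by linarith [hθ.2, Real.pi_gt_three]⟩
  have cX : ContinuousOn X (Icc (-(6 / 5) : ℝ) (6 / 5)) := fun θ hθ =>
    (hext θ (hI hθ)).2.1.continuousAt.continuousWithinAt
  have mX : StrictMonoOn X (Icc (-(6 / 5) : ℝ) (6 / 5)) := by
    apply strictMonoOn_of_deriv_pos (convex_Icc _ _) cX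
    intro θ hθ
    rw [interior_Icc] at hθ
    have hθ' := hI (Ioo_subset_Icc_self hθ)
    rw [(hext θ hθ').2.1.deriv]
    exact div_pos (hcos θ hθ') (hext θ hθ').1
  obtain ⟨g, cg, gl, gr, go, gd⟩ := exists_inverse_of_strictMonoOn (by norm_num) cX mX
  have hsub : Icc (-(Real.pi / 3)) (Real.pi / 3) ⊆ Icc (-(6 / 5) : ℝ) (6 / 5) :=
    Icc_subset_Icc (by linarith) (by linarith)
  have h0 : (0 : ℝ) ∈ Icc (-(Real.pi / 3)) (Real.pi / 3) := ⟨by linarith, by linarith⟩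
  have hr : Real.pi / 3 ∈ Icc (-(Real.pi / 3)) (Real.pi / 3) := ⟨by linarith, le_rfl⟩
  have hlft : -(Real.pi / 3) ∈ Icc (-(Real.pi / 3)) (Real.pi / 3) := ⟨le_rfl, by linarith⟩
  have hX0 : X 0 = 0 := by have := (H.symm h0).1; rw [neg_zero] at this; linarith
  have hXl : X (-(Real.pi / 3)) = -X (Real.pi / 3) := (H.symm hr).1
  refine ⟨X (Real.pi / 3), X (-(6 / 5)), X (6 / 5), Y ∘ g, fun x => -Real.tan (g x), ?_, ?_, ?_,
    rfl, ?_, ?_, ?_⟩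
  · rw [← hX0]
    exact H.strictMonoOn_X h0 hr (by linarith)
  · rw [← hXl]
    exact mX (left_mem_Icc.2 (by norm_num)) (hsub hlft) (by linarith)
  · exact mX (hsub hr) (right_mem_Icc.2 (by norm_num)) (by linarith)
  · intro x hx
    have hg := hI (Ioo_subset_Icc_self (go x hx))
    obtain ⟨e1, e2, e3⟩ := hext _ hg
    have hc := hcos _ hg
    have dg := gd x hx _ e2 (div_pos hc e1).ne'
    refine ⟨(e3.comp x dg).congr_deriv ?_, ((Real.hasDerivAt_tan hc.ne').comp x dg).neg.congr_deriv
      ?_⟩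
    · simp only [Real.tan_eq_sin_div_cos]
      field_simp
    · have e5 : supportFn X Y (g x) = x * Real.sin (g x) + Y (g x) * Real.cos (g x) := by
        rw [supportFn, (gr x (Ioo_subset_Icc_self hx)).2]
      have e6 : x * -Real.tan (g x) - Y (g x) = -(supportFn X Y (g x) / Real.cos (g x)) := by
        rw [e5, Real.tan_eq_sin_div_cos]
        field_simp
        ring
      have e7 : 1 + (-Real.tan (g x)) ^ 2 = 1 / Real.cos (g x) ^ 2 := by
        rw [neg_sq, ← Real.inv_one_add_tan_sq hc.ne']
        field_simp
      rw [Function.comp_apply, e6, e7]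
      field_simp
  · intro θ hθ
    simp only [Function.comp, gl θ (hsub hθ), and_self]
  · intro x hx
    rw [← hXl] at hx
    exact intermediate_value_Icc (by linarith) H.contX hx

/-! ### Coordinates in the plane -/

theorem hasDerivWithinAt_plane {γ : ℝ → Plane} {d : Plane} {S : Set ℝ} {s : ℝ} :
    HasDerivWithinAt γ d S s ↔ HasDerivWithinAt (fun t => γ t 0) (d 0) S s ∧
      HasDerivWithinAt (fun t => γ t 1) (d 1) S s := by
  rw [hasDerivWithinAt_iff_hasFDerivWithinAt, hasFDerivWithinAt_euclidean, Fin.forall_fin_two]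
  refine and_congr ?_ ?_ <;>
  · rw [hasDerivWithinAt_iff_hasFDerivWithinAt]
    exact iff_of_eq (by congr 1)

theorem hasDerivAt_plane {γ : ℝ → Plane} {d : Plane} {s : ℝ} :
    HasDerivAt γ d s ↔ HasDerivAt (fun t => γ t 0) (d 0) s ∧
      HasDerivAt (fun t => γ t 1) (d 1) s := by
  simp only [← hasDerivWithinAt_univ, hasDerivWithinAt_plane]

theorem inner_plane (p q : Plane) : inner ℝ p q = p 0 * q 0 + p 1 * q 1 := by
  simp only [PiLp.inner_apply, Fin.sum_univ_two, RCLike.inner_apply, conj_trivial]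
  ring

theorem norm_sq_plane (p : Plane) : ‖p‖ ^ 2 = p 0 ^ 2 + p 1 ^ 2 := by
  rw [EuclideanSpace.real_norm_sq_eq, Fin.sum_univ_two]

theorem plane_ext {p q : Plane} (h0 : p 0 = q 0) (h1 : p 1 = q 1) : p = q := by
  ext i
  fin_cases i
  · exact h0
  · exact h1
theorem edist_vertical {p q : Plane} (h : p 0 = q 0) : edist p q = ENNReal.ofReal |p 1 - q 1| := by
  rw [edist_dist, EuclideanSpace.dist_eq, Fin.sum_univ_two, h, dist_self, Real.dist_eq]
  congr 1
  rw [zero_pow two_ne_zero, zero_add, sq_abs, Real.sqrt_sq_eq_abs]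

/-! ### The shrinking lens generated by a profile -/

/-- A solution of a smooth second order equation is smooth. -/
theorem contDiffOn_of_profile_equation {u u₁ : ℝ → ℝ} {S : Set ℝ} (hS : IsOpen S)
    (hd : ∀ x ∈ S, HasDerivAt u (u₁ x) x ∧
      HasDerivAt u₁ ((1 + u₁ x ^ 2) * (x * u₁ x - u x)) x) : ContDiffOn ℝ ∞ u S := by
  rw [contDiffOn_infty]
  -- Bootstrap `u` and `u₁` together: the derivative of each is a polynomial in `x`, `u` and `u₁`.
  have key : ∀ n : ℕ, ContDiffOn ℝ n u S ∧ ContDiffOn ℝ n u₁ S := by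
    intro n
    induction n with
    | zero =>
      simp only [Nat.cast_zero, contDiffOn_zero]
      exact ⟨fun x hx => (hd x hx).1.continuousAt.continuousWithinAt,
        fun x hx => (hd x hx).2.continuousAt.continuousWithinAt⟩
    | succ n ih =>
      push_cast
      rw [contDiffOn_succ_iff_deriv_of_isOpen hS, contDiffOn_succ_iff_deriv_of_isOpen hS]
      refine ⟨⟨fun x hx => (hd x hx).1.differentiableAt.differentiableWithinAt, by simp, ?_⟩,
        fun x hx => (hd x hx).2.differentiableAt.differentiableWithinAt, by simp, ?_⟩
      · exact ih.2.congr fun x hx => (hd x hx).1.deriv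
      · exact ((contDiffOn_const.add (ih.2.pow 2)).mul
          ((contDiffOn_id.mul ih.2).sub ih.1)).congr fun x hx => (hd x hx).2.deriv
  exact fun n => (key n).1

/-- A function that solves the profile equation on a neighbourhood of `[-b, b]`, with the boundary
conditions of a self-similar profile. -/
structure IsExtendedProfile (b c₀ c₁ : ℝ) (u u₁ : ℝ → ℝ) : Prop where
  b_pos : 0 < b
  lt_left : c₀ < -b
  right_lt : b < c₁
  hasDerivAt : ∀ x ∈ Ioo c₀ c₁, HasDerivAt u (u₁ x) x ∧
    HasDerivAt u₁ ((1 + u₁ x ^ 2) * (x * u₁ x - u x)) x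
  pos : ∀ x ∈ Ioo (-b) b, 0 < u x
  left_eq : u (-b) = 0
  right_eq : u b = 0
  left_slope : u₁ (-b) = √3
  right_slope : u₁ b = -√3

namespace IsExtendedProfile

variable {b c₀ c₁ : ℝ} {u u₁ : ℝ → ℝ}

theorem subset (H : IsExtendedProfile b c₀ c₁ u u₁) : Icc (-b) b ⊆ Ioo c₀ c₁ := fun _ hx =>
  ⟨H.lt_left.trans_le hx.1, hx.2.trans_lt H.right_lt⟩

theorem isSelfSimilarProfile (H : IsExtendedProfile b c₀ c₁ u u₁) :
    IsSelfSimilarProfile (-b) b u := by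
  have hb : -b < b := by linarith [H.b_pos]
  have hu := uniqueDiffOn_Icc hb
  have hder : ∀ x ∈ Icc (-b) b, derivWithin u (Icc (-b) b) x = u₁ x := fun x hx =>
    (H.hasDerivAt x (H.subset hx)).1.hasDerivWithinAt.derivWithin (hu x hx)
  refine ⟨hb, ?_, H.pos, H.left_eq, H.right_eq, ?_, ?_, ?_⟩
  · exact (contDiffOn_infty.1 ((contDiffOn_of_profile_equation isOpen_Ioo H.hasDerivAt).mono
      H.subset)) 2
  · rw [hder _ (left_mem_Icc.2 hb.le), H.left_slope]
  · rw [hder _ (right_mem_Icc.2 hb.le), H.right_slope]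
  · intro x hx
    have hx' := H.subset (Ioo_subset_Icc_self hx)
    have he : deriv u =ᶠ[𝓝 x] u₁ := by
      filter_upwards [isOpen_Ioo.mem_nhds hx'] with z hz using (H.hasDerivAt z hz).1.deriv
    rw [he.deriv_eq, he.eq_of_nhds, (H.hasDerivAt x hx').2.deriv]

theorem graphCurve_zero (b : ℝ) (u : ℝ → ℝ) (s : ℝ) : graphCurve (-b) b u s 0 = s * b := by
  simp only [graphCurve, Matrix.cons_val_zero]
  ring

theorem graphCurve_one (b : ℝ) (u : ℝ → ℝ) (s : ℝ) : graphCurve (-b) b u s 1 = u (s * b) := by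
  simp only [graphCurve, Matrix.cons_val_one, Matrix.cons_val_fin_one]
  congr 1
  ring

theorem mul_mem (H : IsExtendedProfile b c₀ c₁ u u₁) {s : ℝ} (hs : s ∈ Icc (-1 : ℝ) 1) :
    s * b ∈ Icc (-b) b :=
  ⟨by nlinarith [H.b_pos, hs.1], by nlinarith [H.b_pos, hs.2]⟩

theorem mul_mem_Ioo (H : IsExtendedProfile b c₀ c₁ u u₁) {s : ℝ} (hs : s ∈ Ioo (-1 : ℝ) 1) :
    s * b ∈ Ioo (-b) b :=
  ⟨by nlinarith [H.b_pos, hs.1], by nlinarith [H.b_pos, hs.2]⟩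

theorem hasDerivAt_graphCurve (H : IsExtendedProfile b c₀ c₁ u u₁) (r : ℝ) {s : ℝ}
    (hs : s * b ∈ Ioo c₀ c₁) : HasDerivAt (fun s => r • graphCurve (-b) b u s)
      (r • !₂[b, b * u₁ (s * b)]) s := by
  rw [hasDerivAt_plane]
  simp only [PiLp.smul_apply, graphCurve_zero, graphCurve_one, smul_eq_mul, Matrix.cons_val_zero, Matrix.cons_val_one, Matrix.cons_val_fin_one]
  have h1 : HasDerivAt (fun s : ℝ => s * b) b s := by
    simpa using (hasDerivAt_id' s).mul_const b
  exact ⟨h1.const_mul r, (((H.hasDerivAt _ hs).1.comp s h1).const_mul r).congr_deriv (by ring)⟩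

theorem hasDerivAt_deriv_graphCurve (H : IsExtendedProfile b c₀ c₁ u u₁) (r : ℝ) {s : ℝ}
    (hs : s * b ∈ Ioo c₀ c₁) : HasDerivAt (deriv (fun s => r • graphCurve (-b) b u s))
      (r • !₂[0, b ^ 2 * ((1 + u₁ (s * b) ^ 2) * (s * b * u₁ (s * b) - u (s * b)))]) s := by
  have he : deriv (fun s => r • graphCurve (-b) b u s)
      =ᶠ[𝓝 s] fun s => r • !₂[b, b * u₁ (s * b)] := by
    have : (fun s : ℝ => s * b) ⁻¹' Ioo c₀ c₁ ∈ 𝓝 s :=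
      (isOpen_Ioo.preimage (by fun_prop)).mem_nhds hs
    filter_upwards [this] with z hz using (H.hasDerivAt_graphCurve r hz).deriv
  refine HasDerivAt.congr_of_eventuallyEq ?_ he
  rw [hasDerivAt_plane]
  simp only [PiLp.smul_apply, smul_eq_mul, Matrix.cons_val_zero, Matrix.cons_val_one, Matrix.cons_val_fin_one]
  have h1 : HasDerivAt (fun s : ℝ => s * b) b s := by
    simpa using (hasDerivAt_id' s).mul_const b
  exact ⟨by simpa using hasDerivAt_const s (r * b),
    ((((H.hasDerivAt _ hs).2.comp s h1).const_mul b).const_mul r).congr_deriv (by ring)⟩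

theorem isLensCurve (H : IsExtendedProfile b c₀ c₁ u u₁) {r : ℝ} (hr : 0 < r) :
    IsLensCurve (fun s => r • graphCurve (-b) b u s) := by
  have hb := H.b_pos
  have hrb : 0 < r * b := mul_pos hr hb
  have hI : ∀ s ∈ Icc (-1 : ℝ) 1, s * b ∈ Ioo c₀ c₁ := fun s hs => H.subset (H.mul_mem hs)
  have hder : ∀ s ∈ Icc (-1 : ℝ) 1, derivWithin (fun s => r • graphCurve (-b) b u s) (Icc (-1) 1) s
      = r • !₂[b, b * u₁ (s * b)] := fun s hs =>
    (H.hasDerivAt_graphCurve r (hI s hs)).hasDerivWithinAt.derivWithin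
      (uniqueDiffOn_Icc (by norm_num) s hs)
  have h3 : (√3 : ℝ) ^ 2 = 3 := Real.sq_sqrt (by norm_num)
  have hnorm : ∀ d : ℝ, d ^ 2 = 3 → ‖r • (!₂[b, b * d] : Plane)‖ = 2 * (r * b) := by
    intro d hd
    have h1 : ‖r • (!₂[b, b * d] : Plane)‖ ^ 2 = (2 * (r * b)) ^ 2 := by
      rw [norm_sq_plane]
      simp only [PiLp.smul_apply, smul_eq_mul, Matrix.cons_val_zero, Matrix.cons_val_one, Matrix.cons_val_fin_one]
      linear_combination (r * b) ^ 2 * hd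
    exact (sq_eq_sq₀ (norm_nonneg _) (by positivity)).1 h1
  have hangle : ∀ d : ℝ, d ^ 2 = 3 → ‖r • (!₂[b, b * d] : Plane)‖⁻¹ • r • (!₂[b, b * d] : Plane)
      = !₂[1 / 2, d / 2] := by
    intro d hd
    rw [hnorm d hd]
    apply plane_ext <;>
    · simp only [PiLp.smul_apply, smul_eq_mul, Matrix.cons_val_zero, Matrix.cons_val_one, Matrix.cons_val_fin_one]
      field_simp
  refine ⟨?_, ?_, ?_, ?_, ?_, ?_, ?_, ?_, ?_⟩
  · rw [contDiffOn_euclidean, Fin.forall_fin_two]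
    simp only [PiLp.smul_apply, graphCurve_zero, graphCurve_one, smul_eq_mul]
    exact ⟨by fun_prop, contDiffOn_const.mul
      ((contDiffOn_of_profile_equation isOpen_Ioo H.hasDerivAt).comp (by fun_prop) hI)⟩
  · intro s hs h0
    rw [hder s hs] at h0
    have := congrArg (fun p : Plane => p 0) h0
    simp only [PiLp.smul_apply, smul_eq_mul, Matrix.cons_val_zero,
      PiLp.zero_apply] at this
    exact hrb.ne' this
  · intro s _ t _ hst
    have := congrArg (fun p : Plane => p 0) hst
    simp only [PiLp.smul_apply, smul_eq_mul, graphCurve_zero] at this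
    exact mul_right_cancel₀ hb.ne' (mul_left_cancel₀ hr.ne' this)
  · intro s hs
    simp only [PiLp.smul_apply, smul_eq_mul, graphCurve_one]
    exact mul_pos hr (H.pos _ (H.mul_mem_Ioo hs))
  · simp [graphCurve_one, H.left_eq]
  · simp [graphCurve_one, H.right_eq]
  · simp only [PiLp.smul_apply, smul_eq_mul, graphCurve_zero]
    nlinarith
  · rw [hder _ (by norm_num), neg_one_mul, H.left_slope]
    exact hangle _ h3
  · rw [hder _ (by norm_num), one_mul, H.right_slope, hangle _ (by rw [neg_sq, h3]), neg_div]

end IsExtendedProfile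

/-- The normal equation of curve shortening flow in coordinates. -/
theorem inner_unitNormal_eq_iff {γ : ℝ → Plane} {s : ℝ} (hd : deriv γ s ≠ 0) (A B : Plane) :
    inner ℝ A (unitNormal γ s) = inner ℝ B (unitNormal γ s) / ‖deriv γ s‖ ^ 2 ↔
      (A 1 * deriv γ s 0 - A 0 * deriv γ s 1) * (deriv γ s 0 ^ 2 + deriv γ s 1 ^ 2)
        = B 1 * deriv γ s 0 - B 0 * deriv γ s 1 := by
  have hn : 0 < ‖deriv γ s‖ := norm_pos_iff.2 hd
  rw [unitNormal, real_inner_smul_right, real_inner_smul_right, mul_div_assoc,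
    mul_right_inj' (inv_ne_zero hn.ne'), eq_div_iff (pow_ne_zero 2 hn.ne'), norm_sq_plane,
    inner_plane, inner_plane]
  simp only [Matrix.cons_val_zero, Matrix.cons_val_one, Matrix.cons_val_fin_one]
  constructor <;> intro h <;> linear_combination h

theorem reflectAcrossX1_smul (r : ℝ) (p : Plane) :
    reflectAcrossX1 (r • p) = r • reflectAcrossX1 p := by
  apply plane_ext <;> simp [reflectAcrossX1]

theorem mem_network {γ : ℝ → Plane} {p : Plane} : p ∈ network γ ↔
    (∃ s ∈ Icc (-1 : ℝ) 1, γ s = p) ∨ (∃ s ∈ Icc (-1 : ℝ) 1, reflectAcrossX1 (γ s) = p) ∨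
      (p 1 = 0 ∧ p 0 ≤ γ (-1) 0) ∨ (p 1 = 0 ∧ γ 1 0 ≤ p 0) := by
  simp only [network, mem_union, image_image, mem_ofPred_eq, or_assoc, mem_image]

theorem network_smul {r : ℝ} (hr : 0 < r) (γ : ℝ → Plane) :
    network (fun s => r • γ s) = r • network γ := by
  ext p
  rw [mem_smul_set_iff_inv_smul_mem₀ hr.ne', mem_network, mem_network]
  have h1 : ∀ q : Plane, r • q = p ↔ q = r⁻¹ • p := fun q => by
    rw [eq_inv_smul_iff₀ hr.ne']
  simp only [reflectAcrossX1_smul, h1, PiLp.smul_apply, smul_eq_mul]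
  have h2 : r⁻¹ * p 1 = 0 ↔ p 1 = 0 := by simp [hr.ne']
  have h3 : r⁻¹ * p 0 ≤ γ (-1) 0 ↔ p 0 ≤ r * γ (-1) 0 := by
    rw [inv_mul_le_iff₀ hr]
  have h4 : γ 1 0 ≤ r⁻¹ * p 0 ↔ r * γ 1 0 ≤ p 0 := by
    rw [le_inv_mul_iff₀ hr]
  rw [h2, h3, h4]

theorem hasDerivAt_sqrt_neg_two_mul {t : ℝ} (ht : t < 0) :
    HasDerivAt (fun t : ℝ => √(-2 * t)) (-(√(-2 * t))⁻¹) t := by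
  have h0 : -2 * t ≠ 0 := by linarith
  have hs : 0 < √(-2 * t) := Real.sqrt_pos.2 (by linarith)
  refine (((hasDerivAt_id' t).const_mul (-2)).sqrt h0).congr_deriv ?_
  field_simp

theorem sqrt_neg_two_mul_pos {t : ℝ} (ht : t < 0) : 0 < √(-2 * t) :=
  Real.sqrt_pos.2 (by linarith)

theorem tendsto_sqrt_neg_two_mul : Tendsto (fun t : ℝ => √(-2 * t)) (𝓝[<] 0) (𝓝 0) := by
  have : Continuous fun t : ℝ => √(-2 * t) := by fun_prop
  have := this.tendsto 0
  rw [mul_zero, Real.sqrt_zero] at this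
  exact this.mono_left nhdsWithin_le_nhds

namespace IsExtendedProfile

variable {b c₀ c₁ : ℝ} {u u₁ : ℝ → ℝ}

/-- With `r = √(-2t)` one has `r' = -1/r`, so both sides of the normal equation scale by the same
power of `r`, and the profile equation remains. -/
theorem isLensFlow (H : IsExtendedProfile b c₀ c₁ u u₁) :
    IsLensFlow (fun t s => √(-2 * t) • graphCurve (-b) b u s) := by
  have hd : ∀ t < 0, ∀ s, HasDerivAt (fun τ => √(-2 * τ) • graphCurve (-b) b u s)
      (-(√(-2 * t))⁻¹ • graphCurve (-b) b u s) t := fun t ht s =>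
    (hasDerivAt_sqrt_neg_two_mul ht).smul_const _
  refine ⟨fun t ht => H.isLensCurve (sqrt_neg_two_mul_pos ht),
    fun t ht s _ => (hd t ht s).differentiableAt, fun t ht s hs => ?_⟩
  have hr := sqrt_neg_two_mul_pos ht
  have hs' := H.subset (H.mul_mem (Ioo_subset_Icc_self hs))
  have e1 := (H.hasDerivAt_graphCurve (√(-2 * t)) hs').deriv
  have e2 := (H.hasDerivAt_deriv_graphCurve (√(-2 * t)) hs').deriv
  have hb := H.b_pos
  rw [inner_unitNormal_eq_iff, (hd t ht s).deriv, e1, e2]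
  · simp only [PiLp.smul_apply, smul_eq_mul, graphCurve_zero, graphCurve_one, Matrix.cons_val_zero, Matrix.cons_val_one, Matrix.cons_val_fin_one]
    field_simp
    ring
  · rw [e1]
    intro h0
    have := congrArg (fun p : Plane => p 0) h0
    simp only [PiLp.smul_apply, smul_eq_mul, Matrix.cons_val_zero,
      PiLp.zero_apply] at this
    exact (mul_pos hr hb).ne' this

/-- Vertical projection moves no point of the network by more than `r C`, and each axis point
between the vertices lies below a point of the graph. -/
theorem hausdorffEDist_network_le (H : IsExtendedProfile b c₀ c₁ u u₁) {C r : ℝ} (hr : 0 < r)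
    (hC : ∀ x ∈ Icc (-b) b, |u x| ≤ C) :
    Metric.hausdorffEDist (network (fun s => r • graphCurve (-b) b u s)) x1Axis
      ≤ ENNReal.ofReal (r * C) := by
  have hb := H.b_pos
  have hu : ∀ s ∈ Icc (-1 : ℝ) 1, |r * u (s * b)| ≤ r * C := fun s hs => by
    rw [abs_mul, abs_of_pos hr]
    exact mul_le_mul_of_nonneg_left (hC _ (H.mul_mem hs)) hr.le
  apply Metric.hausdorffEDist_le_of_mem_edist
  · intro p hp
    refine ⟨!₂[p 0, 0], by simp [x1Axis], ?_⟩
    rw [edist_vertical (by simp)]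
    apply ENNReal.ofReal_le_ofReal
    simp only [Matrix.cons_val_one, Matrix.cons_val_fin_one, sub_zero]
    rcases mem_network.1 hp with ⟨s, hs, rfl⟩ | ⟨s, hs, rfl⟩ | h | h
    · simpa [graphCurve_one] using hu s hs
    · simpa [graphCurve_one, reflectAcrossX1] using hu s hs
    · rw [h.1, abs_zero]
      exact (abs_nonneg _).trans (hu 0 (by norm_num))
    · rw [h.1, abs_zero]
      exact (abs_nonneg _).trans (hu 0 (by norm_num))
  · intro p hp
    have hp1 : p 1 = 0 := hp
    by_cases hl : p 0 ≤ r * -b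
    · refine ⟨p, mem_network.2 (Or.inr (Or.inr (Or.inl ⟨hp1, ?_⟩))), by simp⟩
      simpa [graphCurve_zero] using hl
    by_cases hr' : r * b ≤ p 0
    · refine ⟨p, mem_network.2 (Or.inr (Or.inr (Or.inr ⟨hp1, ?_⟩))), by simp⟩
      simpa [graphCurve_zero] using hr'
    rw [not_le] at hl hr'
    have hrb : 0 < r * b := mul_pos hr hb
    have hs : p 0 / (r * b) ∈ Icc (-1 : ℝ) 1 :=
      ⟨by rw [le_div_iff₀ hrb]; linarith, by rw [div_le_iff₀ hrb]; linarith⟩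
    refine ⟨_, mem_network.2 (Or.inl ⟨p 0 / (r * b), hs, rfl⟩), ?_⟩
    rw [edist_vertical]
    · apply ENNReal.ofReal_le_ofReal
      simpa [hp1, graphCurve_one] using hu _ hs
    · simp only [PiLp.smul_apply, smul_eq_mul, graphCurve_zero]
      field_simp

theorem isSelfSimilarlyShrinkingLens (H : IsExtendedProfile b c₀ c₁ u u₁) :
    IsSelfSimilarlyShrinkingLens (fun t s => √(-2 * t) • graphCurve (-b) b u s) := by
  refine ⟨H.isLensFlow, ?_, ?_⟩
  · intro t₁ ht₁ t₂ ht₂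
    have h1 := sqrt_neg_two_mul_pos ht₁
    have h2 := sqrt_neg_two_mul_pos ht₂
    refine ⟨√(-2 * t₁) / √(-2 * t₂), div_pos h1 h2, ?_⟩
    rw [network_smul h1, network_smul h2, smul_smul, div_mul_cancel₀ _ h2.ne']
  · obtain ⟨C, hC⟩ := isCompact_Icc.exists_bound_of_continuousOn
      (fun x hx => (H.hasDerivAt x (H.subset hx)).1.continuousAt.continuousWithinAt :
        ContinuousOn u (Icc (-b) b))
    have hlim : Tendsto (fun t : ℝ => ENNReal.ofReal (√(-2 * t) * C)) (𝓝[<] 0) (𝓝 0) := by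
      have := ENNReal.tendsto_ofReal (tendsto_sqrt_neg_two_mul.mul_const C)
      rwa [zero_mul, ENNReal.ofReal_zero] at this
    refine tendsto_of_tendsto_of_tendsto_of_le_of_le' tendsto_const_nhds hlim
      (Eventually.of_forall fun _ => zero_le) ?_
    filter_upwards [self_mem_nhdsWithin] with t ht
    exact H.hausdorffEDist_network_le (sqrt_neg_two_mul_pos ht) hC

end IsExtendedProfile

/-! ### Curves whose curvature is a multiple of the support function -/

/-- A continuous function without zeros on an interval is positive if it is positive somewhere. -/
theorem continuousOn_pos_of_ne_zero {N : ℝ → ℝ} {a b z : ℝ} (hc : ContinuousOn N (Icc a b))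
    (hne : ∀ x ∈ Icc a b, N x ≠ 0) (hz : z ∈ Icc a b) (hpos : 0 < N z) :
    ∀ x ∈ Icc a b, 0 < N x := by
  intro x hx
  by_contra hle
  obtain ⟨w, hw, hw'⟩ := isPreconnected_Icc.intermediate_value hx hz hc ⟨not_lt.1 hle, hpos.le⟩
  exact hne w hw hw'

/-- The support function of a planar curve `(x, y)` with curvature `c` times its support function
does not vanish if it does not vanish at one point. -/
theorem wedge_ne_zero {x y p q P Q : ℝ → ℝ} {a b c : ℝ}
    (cx : ContinuousOn x (Icc a b)) (cy : ContinuousOn y (Icc a b))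
    (cp : ContinuousOn p (Icc a b)) (cq : ContinuousOn q (Icc a b))
    (dx : ∀ s ∈ Ioo a b, HasDerivAt x (p s) s) (dy : ∀ s ∈ Ioo a b, HasDerivAt y (q s) s)
    (dp : ∀ s ∈ Ioo a b, HasDerivAt p (P s) s) (dq : ∀ s ∈ Ioo a b, HasDerivAt q (Q s) s)
    (hreg : ∀ s ∈ Icc a b, 0 < p s ^ 2 + q s ^ 2)
    (heq : ∀ s ∈ Ioo a b, c * (y s * p s - x s * q s) * (p s ^ 2 + q s ^ 2)
      = Q s * p s - P s * q s)
    {z : ℝ} (hz : z ∈ Icc a b) (hNz : y z * p z - x z * q z ≠ 0) :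
    ∀ s ∈ Icc a b, y s * p s - x s * q s ≠ 0 := by
  intro w hw h0
  obtain ⟨K, hK⟩ := isCompact_Icc.exists_bound_of_continuousOn
    ((cx.mul cp).add (cy.mul cq) |>.const_smul (2 * c))
  have cN : ContinuousOn (fun s => y s * p s - x s * q s) (Icc a b) := (cy.mul cp).sub (cx.mul cq)
  -- The quotient is the squared support function `⟨γ, ν⟩²`. Dividing by the squared speed removes
  -- the dependence on the parametrization and leaves `G' = -2c ⟨γ, γ'⟩ G`.
  have := eq_zero_of_abs_deriv_le
    (G := fun s => (y s * p s - x s * q s) ^ 2 / (p s ^ 2 + q s ^ 2))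
    (G' := fun s => -(2 * c * (x s * p s + y s * q s))
      * ((y s * p s - x s * q s) ^ 2 / (p s ^ 2 + q s ^ 2))) (C := K)
    ((cN.pow 2).div ((cp.pow 2).add (cq.pow 2)) fun s hs => (hreg s hs).ne')
    (fun s hs => by
      have hm := (hreg s (Ioo_subset_Icc_self hs)).ne'
      refine ((((((dy s hs).mul (dp s hs)).sub ((dx s hs).mul (dq s hs))).pow 2)).div
        (((dp s hs).pow 2).add ((dq s hs).pow 2)) hm).congr_deriv ?_
      have e := heq s hs
      simp only [Pi.add_apply, Pi.sub_apply, Pi.mul_apply, Pi.pow_apply]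
      field_simp
      push_cast
      linear_combination (2 * (y s * p s - x s * q s) * (x s * p s + y s * q s)) * e)
    (fun s hs => div_nonneg (sq_nonneg _) (hreg s hs).le)
    (fun s hs => by
      have := hK s (Ioo_subset_Icc_self hs)
      rw [abs_mul, abs_neg, abs_of_nonneg (div_nonneg (sq_nonneg _)
        (hreg s (Ioo_subset_Icc_self hs)).le)]
      exact mul_le_mul_of_nonneg_right (by simpa using this) (div_nonneg (sq_nonneg _)
        (hreg s (Ioo_subset_Icc_self hs)).le))
    hw (by simp [h0]) z hz
  have h1 := hreg z hz
  rcases div_eq_zero_iff.1 this with h | h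
  · exact hNz (by simpa using h)
  · exact h1.ne' h

/-- Half-angle formula: `2 arctan(q/(n+p))` is the angle of `(p, q)`. It stays regular at vertical
tangents, where `arctan(q/p)` breaks down, and fails only in the direction `(-1, 0)`. -/
theorem cos_sin_two_arctan {p q n : ℝ} (hn : n ^ 2 = p ^ 2 + q ^ 2) (h0 : n ≠ 0) (hp : n + p ≠ 0) :
    n * Real.cos (-(2 * Real.arctan (q / (n + p)))) = p ∧
      n * Real.sin (-(2 * Real.arctan (q / (n + p)))) = -q := by
  have h1 : 1 + (q / (n + p)) ^ 2 = 2 * n / (n + p) := by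
    field_simp
    linear_combination -hn
  rw [Real.cos_neg, Real.sin_neg, Real.cos_two_mul, Real.sin_two_mul, Real.cos_sq_arctan]
  have h2 : Real.sin (Real.arctan (q / (n + p))) * Real.cos (Real.arctan (q / (n + p)))
      = q / (n + p) * (1 / (1 + (q / (n + p)) ^ 2)) := by
    rw [← Real.cos_sq_arctan]
    nth_rewrite 3 [← Real.tan_arctan (q / (n + p))]
    rw [Real.tan_eq_sin_div_cos]
    have := (Real.cos_arctan_pos (q / (n + p))).ne'
    field_simp
  rw [mul_assoc 2, h2, h1]
  constructor <;> · field_simp; try ring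

/-- A planar arc in the upper half-plane with `60°` angles, whose curvature is `c` times its
support function, is up to scaling a shrinker arc. -/
theorem exists_shrinkerArc_of_curvature_eq {x y p q P Q : ℝ → ℝ} {c : ℝ}
    (cx : ContinuousOn x (Icc (-1) 1)) (cy : ContinuousOn y (Icc (-1) 1))
    (cp : ContinuousOn p (Icc (-1) 1)) (cq : ContinuousOn q (Icc (-1) 1))
    (dx : ∀ s ∈ Ioo (-1 : ℝ) 1, HasDerivAt x (p s) s)
    (dy : ∀ s ∈ Ioo (-1 : ℝ) 1, HasDerivAt y (q s) s)
    (dp : ∀ s ∈ Ioo (-1 : ℝ) 1, HasDerivAt p (P s) s)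
    (dq : ∀ s ∈ Ioo (-1 : ℝ) 1, HasDerivAt q (Q s) s)
    (hreg : ∀ s ∈ Icc (-1 : ℝ) 1, 0 < p s ^ 2 + q s ^ 2)
    (heq : ∀ s ∈ Ioo (-1 : ℝ) 1, c * (y s * p s - x s * q s) * (p s ^ 2 + q s ^ 2)
      = Q s * p s - P s * q s)
    (hy : ∀ s ∈ Ioo (-1 : ℝ) 1, 0 < y s) (yl : y (-1) = 0) (yr : y 1 = 0) (hx : x (-1) < x 1)
    (pl : 0 < p (-1)) (ql : q (-1) = √3 * p (-1)) (pr : 0 < p 1) (qr : q 1 = -(√3 * p 1)) :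
    ∃ (k : ℝ) (X Y : ℝ → ℝ), 0 < k ∧ c = -k ^ 2 ∧ IsShrinkerArc X Y ∧
      X (-(Real.pi / 3)) = k * x (-1) ∧ X (Real.pi / 3) = k * x 1 ∧
      (∀ s ∈ Icc (-1 : ℝ) 1, ∃ θ ∈ Icc (-(Real.pi / 3)) (Real.pi / 3),
        X θ = k * x s ∧ Y θ = k * y s) ∧
      ∀ θ ∈ Icc (-(Real.pi / 3)) (Real.pi / 3), ∃ s ∈ Icc (-1 : ℝ) 1,
        X θ = k * x s ∧ Y θ = k * y s := by
  have hl : (-1 : ℝ) ∈ Icc (-1 : ℝ) 1 := by norm_num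
  have hr : (1 : ℝ) ∈ Icc (-1 : ℝ) 1 := by norm_num
  have h3 : 0 < √3 := by positivity
  have h33 : √3 ^ 2 = 3 := Real.sq_sqrt (by norm_num)
  set N : ℝ → ℝ := fun s => y s * p s - x s * q s with hN
  have cN : ContinuousOn N (Icc (-1) 1) := (cy.mul cp).sub (cx.mul cq)
  have Nl : N (-1) = -(√3 * p (-1)) * x (-1) := by simp only [hN, yl, ql]; ring
  have Nr : N 1 = √3 * p 1 * x 1 := by simp only [hN, yr, qr]; ring
  -- The `60°` angles make `N` a positive multiple of `-x(-1)` and of `x(1)` at the two ends; as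
  -- `x(-1) < x(1)`, at least one of these is positive.
  have hNne : ∀ s ∈ Icc (-1 : ℝ) 1, N s ≠ 0 := by
    by_cases h : x 1 = 0
    · refine wedge_ne_zero cx cy cp cq dx dy dp dq hreg heq hl (ne_of_gt ?_)
      change 0 < N (-1)
      rw [Nl]
      have : 0 < √3 * p (-1) := by positivity
      nlinarith
    · refine wedge_ne_zero cx cy cp cq dx dy dp dq hreg heq hr ?_
      change N 1 ≠ 0
      rw [Nr]
      positivity
  have hNpos : ∀ s ∈ Icc (-1 : ℝ) 1, 0 < N s := by
    have hA : 0 < √3 * p (-1) := by positivity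
    have hB : 0 < √3 * p 1 := by positivity
    rcases lt_or_ge 0 (x 1) with h | h
    · exact continuousOn_pos_of_ne_zero cN hNne hr (by rw [Nr]; positivity)
    · exact continuousOn_pos_of_ne_zero cN hNne hl (by rw [Nl]; nlinarith)
  set n : ℝ → ℝ := fun s => √(p s ^ 2 + q s ^ 2) with hn
  have hnsq : ∀ s, n s ^ 2 = p s ^ 2 + q s ^ 2 := fun s => Real.sq_sqrt (by positivity)
  have hnpos : ∀ s ∈ Icc (-1 : ℝ) 1, 0 < n s := fun s hs => Real.sqrt_pos.2 (hreg s hs)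
  have cn : ContinuousOn n (Icc (-1) 1) := ((cp.pow 2).add (cq.pow 2)).sqrt
  have dn : ∀ s ∈ Ioo (-1 : ℝ) 1, HasDerivAt n ((p s * P s + q s * Q s) / n s) s := by
    intro s hs
    have h1 := hnpos s (Ioo_subset_Icc_self hs)
    refine (((dp s hs).pow 2).add ((dq s hs).pow 2)).sqrt
      (hreg s (Ioo_subset_Icc_self hs)).ne' |>.congr_deriv ?_
    change (_ : ℝ) / (2 * n s) = _
    field_simp
    push_cast
    ring
  have nl : n (-1) = 2 * p (-1) := by
    have : n (-1) ^ 2 = (2 * p (-1)) ^ 2 := by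
      rw [hnsq, ql]; linear_combination p (-1) ^ 2 * h33
    exact (sq_eq_sq₀ (hnpos _ hl).le (by positivity)).1 this
  have nr : n 1 = 2 * p 1 := by
    have : n 1 ^ 2 = (2 * p 1) ^ 2 := by
      rw [hnsq, qr]; linear_combination p 1 ^ 2 * h33
    exact (sq_eq_sq₀ (hnpos _ hr).le (by positivity)).1 this
  -- The tangent never points in the direction `(-1, 0)`: there `q = 0` and `p < 0`, so `N = y p ≤
  -- 0`.
  have hnp : ∀ s ∈ Icc (-1 : ℝ) 1, 0 < n s + p s := by
    intro s hs
    have hn0 := hnpos s hs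
    by_contra hle
    rw [not_lt] at hle
    have hp : p s < 0 := by linarith
    have hq : q s = 0 := by nlinarith [hnsq s, sq_nonneg (q s)]
    have hNs := hNpos s hs
    simp only [hN, hq, mul_zero, sub_zero] at hNs
    have hys : 0 ≤ y s := by
      rcases hs.1.eq_or_lt with h | h
      · rw [← h, yl]
      rcases hs.2.eq_or_lt with h' | h'
      · rw [h', yr]
      · exact (hy s ⟨h, h'⟩).le
    nlinarith
  set τ : ℝ → ℝ := fun s => q s / (n s + p s) with hτ
  have cτ : ContinuousOn τ (Icc (-1) 1) := cq.div (cn.add cp) fun s hs => (hnp s hs).ne'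
  have dτ : ∀ s ∈ Ioo (-1 : ℝ) 1, HasDerivAt τ (c * N s * n s / (n s + p s)) s := by
    intro s hs
    have h1 := hnpos s (Ioo_subset_Icc_self hs)
    have h2 := hnp s (Ioo_subset_Icc_self hs)
    refine ((dq s hs).div ((dn s hs).add (dp s hs)) h2.ne').congr_deriv ?_
    have e := heq s hs
    have e2 := hnsq s
    rw [← e2] at e
    change c * N s * n s ^ 2 = _ at e
    simp only [Pi.add_apply]
    have hA : Q s * (n s + p s) - q s * ((p s * P s + q s * Q s) / n s + P s)
        = c * N s * n s * (n s + p s) := by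
      apply mul_left_cancel₀ h1.ne'
      have e3 : n s * ((p s * P s + q s * Q s) / n s) = p s * P s + q s * Q s := by field_simp
      linear_combination (-(n s + p s)) * e - q s * e3 + Q s * e2
    rw [hA]
    field_simp
  have τl : τ (-1) = 1 / √3 := by
    simp only [hτ, nl, ql]
    field_simp
    linear_combination h33
  have τr : τ 1 = -(1 / √3) := by
    simp only [hτ, nr, qr]
    field_simp
    linear_combination -h33
  -- The half-angle tangent `τ` falls from `1/√3` to `-1/√3`, while its derivative has the sign of
  -- `c`.
  have hc : c < 0 := by
    by_contra hc
    rw [not_lt] at hc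
    have hmono : MonotoneOn τ (Icc (-1) 1) := by
      apply monotoneOn_of_deriv_nonneg (convex_Icc _ _) cτ
      · intro s hs
        rw [interior_Icc] at hs
        exact (dτ s hs).differentiableAt.differentiableWithinAt
      · intro s hs
        rw [interior_Icc] at hs
        rw [(dτ s hs).deriv]
        have hs' := Ioo_subset_Icc_self hs
        exact div_nonneg (mul_nonneg (mul_nonneg hc (hNpos s hs').le) (hnpos s hs').le)
          (hnp s hs').le
    have := hmono hl hr (by norm_num)
    rw [τl, τr] at this
    have : 0 < 1 / √3 := by positivity
    linarith
  -- Dilation by `k` divides the curvature by `k` and multiplies the support function by `k`, so `k²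
  -- = -c` normalizes the factor `c` to `-1`.
  set k : ℝ := √(-c) with hk
  have hk0 : 0 < k := Real.sqrt_pos.2 (by linarith)
  have hk2 : k ^ 2 = -c := Real.sq_sqrt (by linarith)
  have hcs : ∀ s ∈ Icc (-1 : ℝ) 1, n s * Real.cos (-(2 * Real.arctan (τ s))) = p s ∧
      n s * Real.sin (-(2 * Real.arctan (τ s))) = -q s := fun s hs =>
    cos_sin_two_arctan (hnsq s) (hnpos s hs).ne' (hnp s hs).ne'
  have hlh : ∀ s ∈ Icc (-1 : ℝ) 1, k * n s * (k * x s * Real.sin (-(2 * Real.arctan (τ s)))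
      + k * y s * Real.cos (-(2 * Real.arctan (τ s)))) = k ^ 2 * N s := by
    intro s hs
    obtain ⟨h1, h2⟩ := hcs s hs
    simp only [hN]
    linear_combination k ^ 2 * y s * h1 + k ^ 2 * x s * h2
  have harc : Real.arctan (1 / √3) = Real.pi / 6 := by
    rw [← Real.tan_pi_div_six]
    exact Real.arctan_tan (by linarith [Real.pi_pos]) (by linarith [Real.pi_pos])
  have ϑl : -(2 * Real.arctan (τ (-1))) = -(Real.pi / 3) := by
    rw [τl, harc]; ring
  have ϑr : -(2 * Real.arctan (τ 1)) = Real.pi / 3 := by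
    rw [τr, Real.arctan_neg, harc]; ring
  obtain ⟨X, Y, hXY, h1, h2⟩ := exists_shrinkerArc_of_curve (x := fun s => k * x s)
    (y := fun s => k * y s) (ϑ := fun s => -(2 * Real.arctan (τ s))) (l := fun s => k * n s)
    (by norm_num : (-1 : ℝ) < 1) (continuousOn_const.mul cx) (continuousOn_const.mul cy)
    (continuousOn_const.mul (Real.continuous_arctan.comp_continuousOn cτ)).neg
    (fun s hs => ((dx s hs).const_mul k).congr_deriv (by
      rw [mul_assoc, (hcs s (Ioo_subset_Icc_self hs)).1]))
    (fun s hs => ((dy s hs).const_mul k).congr_deriv (by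
      rw [mul_assoc, (hcs s (Ioo_subset_Icc_self hs)).2]; ring))
    (fun s hs => by
      have hs' := Ioo_subset_Icc_self hs
      rw [hlh s hs', hk2]
      refine (((dτ s hs).arctan).const_mul 2).neg.congr_deriv ?_
      have e1 := hnpos s hs'
      have e2 := hnp s hs'
      have e3 : 1 + τ s ^ 2 = 2 * n s / (n s + p s) := by
        simp only [hτ]
        field_simp
        linear_combination -hnsq s
      rw [e3]
      field_simp)
    (fun s hs => mul_pos hk0 (hnpos s (Ioo_subset_Icc_self hs)))
    (fun s hs => by
      have e1 := hlh s hs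
      have e2 : 0 < k * n s := mul_pos hk0 (hnpos s hs)
      have e3 : 0 < k ^ 2 * N s := mul_pos (pow_pos hk0 2) (hNpos s hs)
      rw [← e1] at e3
      exact (mul_pos_iff_of_pos_left e2).1 e3)
    ϑl ϑr (by simp [yl]) (by simp [yr])
  refine ⟨k, X, Y, hk0, by rw [hk2, neg_neg], hXY, ?_, ?_,
    fun s hs => ⟨_, (h1 s hs).1, (h1 s hs).2⟩, fun θ hθ => ?_⟩
  · rw [← ϑl]
    exact (h1 (-1) hl).2.1
  · rw [← ϑr]
    exact (h1 1 hr).2.1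
  · obtain ⟨s, hs, rfl⟩ := h2 θ hθ
    exact ⟨s, hs, (h1 s hs).2⟩

/-- First and second derivatives of a lens curve. -/
theorem IsLensCurve.hasDerivAt {γ : ℝ → Plane} (H : IsLensCurve γ) :
    ContinuousOn (derivWithin γ (Icc (-1) 1)) (Icc (-1) 1) ∧ ∀ s ∈ Ioo (-1 : ℝ) 1,
      HasDerivAt γ (derivWithin γ (Icc (-1) 1) s) s ∧
      HasDerivAt (derivWithin γ (Icc (-1) 1)) (deriv (deriv γ) s) s ∧
      deriv γ s = derivWithin γ (Icc (-1) 1) s := by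
  have hu := uniqueDiffOn_Icc (by norm_num : (-1 : ℝ) < 1)
  have h2 : ContDiffOn ℝ (1 + 1) γ (Icc (-1) 1) := by
    have := (contDiffOn_infty.1 H.smooth) 2
    rwa [show ((2 : ℕ) : WithTop ℕ∞) = 1 + 1 from (one_add_one_eq_two).symm] at this
  obtain ⟨hd, -, hD⟩ := (contDiffOn_succ_iff_derivWithin hu).1 h2
  refine ⟨hD.continuousOn, fun s hs => ?_⟩
  have hn : Icc (-1 : ℝ) 1 ∈ 𝓝 s := Icc_mem_nhds hs.1 hs.2
  have hv := (hd s (Ioo_subset_Icc_self hs)).hasDerivWithinAt.hasDerivAt hn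
  have hD' := ((hD.differentiableOn one_ne_zero) s (Ioo_subset_Icc_self hs)).differentiableAt hn
  have he : derivWithin γ (Icc (-1) 1) =ᶠ[𝓝 s] deriv γ := by
    filter_upwards [isOpen_Ioo.mem_nhds hs] with z hz
    exact derivWithin_of_mem_nhds (Icc_mem_nhds hz.1 hz.2)
  exact ⟨hv, hD'.hasDerivAt.congr_deriv he.deriv_eq, hv.deriv⟩

/-- A lens curve that moves by homotheties under curve shortening flow is up to scaling a shrinker
arc. -/
theorem IsLensCurve.exists_shrinkerArc {γ : ℝ → Plane} (H : IsLensCurve γ) {c : ℝ}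
    (hc : ∀ s ∈ Ioo (-1 : ℝ) 1,
      c * (γ s 1 * deriv γ s 0 - γ s 0 * deriv γ s 1) * (deriv γ s 0 ^ 2 + deriv γ s 1 ^ 2)
        = deriv (deriv γ) s 1 * deriv γ s 0 - deriv (deriv γ) s 0 * deriv γ s 1) :
    ∃ (k : ℝ) (X Y : ℝ → ℝ), 0 < k ∧ c = -k ^ 2 ∧ IsShrinkerArc X Y ∧
      X (-(Real.pi / 3)) = k * γ (-1) 0 ∧ X (Real.pi / 3) = k * γ 1 0 ∧
      (∀ s ∈ Icc (-1 : ℝ) 1, ∃ θ ∈ Icc (-(Real.pi / 3)) (Real.pi / 3),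
        X θ = k * γ s 0 ∧ Y θ = k * γ s 1) ∧
      ∀ θ ∈ Icc (-(Real.pi / 3)) (Real.pi / 3), ∃ s ∈ Icc (-1 : ℝ) 1,
        X θ = k * γ s 0 ∧ Y θ = k * γ s 1 := by
  obtain ⟨cD, hd⟩ := H.hasDerivAt
  have cγ := H.smooth.continuousOn
  have hreg := H.regular
  have hl := H.left_angle
  have hr := H.right_angle
  set D := derivWithin γ (Icc (-1) 1)
  have hcoord : ∀ i : Fin 2, Continuous fun p : Plane => p i := fun i => by fun_prop
  have hnl : 0 < ‖D (-1)‖ := norm_pos_iff.2 (hreg _ (by norm_num))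
  have hnr : 0 < ‖D 1‖ := norm_pos_iff.2 (hreg _ (by norm_num))
  rw [inv_smul_eq_iff₀ hnl.ne'] at hl
  rw [inv_smul_eq_iff₀ hnr.ne'] at hr
  have hl0 : D (-1) 0 = ‖D (-1)‖ * (1 / 2) := congrArg (fun p : Plane => p 0) hl
  have hl1 : D (-1) 1 = ‖D (-1)‖ * (√3 / 2) := congrArg (fun p : Plane => p 1) hl
  have hr0 : D 1 0 = ‖D 1‖ * (1 / 2) := congrArg (fun p : Plane => p 0) hr
  have hr1 : D 1 1 = ‖D 1‖ * -(√3 / 2) := congrArg (fun p : Plane => p 1) hr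
  exact exists_shrinkerArc_of_curvature_eq (x := fun s => γ s 0) (y := fun s => γ s 1)
    (p := fun s => D s 0) (q := fun s => D s 1) (P := fun s => deriv (deriv γ) s 0)
    (Q := fun s => deriv (deriv γ) s 1)
    ((hcoord 0).comp_continuousOn cγ) ((hcoord 1).comp_continuousOn cγ)
    ((hcoord 0).comp_continuousOn cD) ((hcoord 1).comp_continuousOn cD)
    (fun s hs => (hasDerivAt_plane.1 (hd s hs).1).1)
    (fun s hs => (hasDerivAt_plane.1 (hd s hs).1).2)
    (fun s hs => (hasDerivAt_plane.1 (hd s hs).2.1).1)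
    (fun s hs => (hasDerivAt_plane.1 (hd s hs).2.1).2)
    (fun s hs => by
      rw [← norm_sq_plane]
      exact pow_pos (norm_pos_iff.2 (hreg s hs)) 2)
    (fun s hs => by
      have := hc s hs
      rwa [(hd s hs).2.2] at this)
    H.upper H.left_mem H.right_mem H.left_lt_right
    (by rw [hl0]; positivity) (by rw [hl0, hl1]; ring)
    (by rw [hr0]; positivity) (by rw [hr0, hr1]; ring)

/-! ### Homothetic networks and the curvature equation of a time slice -/

theorem IsLensCurve.mem_network_of_pos {γ : ℝ → Plane} (H : IsLensCurve γ) {p : Plane}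
    (hp : 0 < p 1) : p ∈ network γ ↔ p ∈ γ '' Icc (-1) 1 := by
  rw [mem_network]
  constructor
  · rintro (h | ⟨s, hs, rfl⟩ | h | h)
    · exact h
    · have h1 : 0 ≤ γ s 1 := by
        rcases hs.1.eq_or_lt with h | h
        · rw [← h, H.left_mem]
        rcases hs.2.eq_or_lt with h' | h'
        · rw [h', H.right_mem]
        · exact (H.upper s ⟨h, h'⟩).le
      have h2 : reflectAcrossX1 (γ s) 1 = -γ s 1 := by simp [reflectAcrossX1]
      linarith
    · exact absurd h.1 hp.ne'
    · exact absurd h.1 hp.ne'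
  · exact fun h => Or.inl h

/-- The trace of the network on the axis is the complement of the open interval between the
vertices, so the vertices are determined by the network as a set. -/
theorem IsLensCurve.mem_network_of_eq_zero {γ : ℝ → Plane} (H : IsLensCurve γ) {p : Plane}
    (hp : p 1 = 0) : p ∈ network γ ↔ p 0 ≤ γ (-1) 0 ∨ γ 1 0 ≤ p 0 := by
  rw [mem_network]
  have key : ∀ s ∈ Icc (-1 : ℝ) 1, γ s 1 = 0 → γ s 0 ≤ γ (-1) 0 ∨ γ 1 0 ≤ γ s 0 := by
    intro s hs h0
    rcases hs.1.eq_or_lt with h | h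
    · rw [← h]; exact Or.inl le_rfl
    rcases hs.2.eq_or_lt with h' | h'
    · rw [h']; exact Or.inr le_rfl
    · exact absurd h0 (H.upper s ⟨h, h'⟩).ne'
  constructor
  · rintro (⟨s, hs, rfl⟩ | ⟨s, hs, rfl⟩ | h | h)
    · exact key s hs hp
    · have h1 : reflectAcrossX1 (γ s) 1 = -γ s 1 := by simp [reflectAcrossX1]
      have h2 : reflectAcrossX1 (γ s) 0 = γ s 0 := by simp [reflectAcrossX1]
      rw [h2]
      exact key s hs (by linarith)
    · exact Or.inl h.2
    · exact Or.inr h.2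
  · rintro (h | h)
    · exact Or.inr (Or.inr (Or.inl ⟨hp, h⟩))
    · exact Or.inr (Or.inr (Or.inr ⟨hp, h⟩))

theorem endpoints_eq_of_forall_iff {a b a' b' : ℝ} (hab : a < b) (hab' : a' < b')
    (h : ∀ x : ℝ, (x ≤ a ∨ b ≤ x) ↔ (x ≤ a' ∨ b' ≤ x)) : a = a' ∧ b = b' := by
  have aux : ∀ {a b a' b' : ℝ}, a < b → a' < b' →
      (∀ x : ℝ, (x ≤ a ∨ b ≤ x) ↔ (x ≤ a' ∨ b' ≤ x)) → a' ≤ a ∧ b ≤ b' := by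
    intro a b a' b' hab hab' h
    have ha : a' ≤ a ∨ b ≤ a' := (h a').2 (Or.inl le_rfl)
    have hb : b' ≤ a ∨ b ≤ b' := (h b').2 (Or.inr le_rfl)
    constructor
    · by_contra hlt
      rw [not_le] at hlt
      -- If `a < a'`, the point `a'` can belong to the complement of `(a, b)` only when `b ≤ a'`;
      -- but then the midpoint of `(a, b)` would belong to it as well.
      have h2 : b ≤ a' := ha.resolve_left (not_le.2 hlt)
      have h3 := (h ((a + b) / 2)).2 (Or.inl (by linarith))
      rcases h3 with h3 | h3 <;> linarith
    · by_contra hlt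
      rw [not_le] at hlt
      have h2 : b' ≤ a := hb.resolve_right (not_le.2 hlt)
      have h3 := (h ((a + b) / 2)).2 (Or.inr (by linarith))
      rcases h3 with h3 | h3 <;> linarith
  have h1 := aux hab hab' h
  have h2 := aux hab' hab fun x => (h x).symm
  exact ⟨le_antisymm h2.1 h1.1, le_antisymm h1.2 h2.2⟩

/-- The end points of homothetic lens-shaped networks correspond to each other. -/
theorem IsLensCurve.endpoints_eq {γ γ' : ℝ → Plane} (H : IsLensCurve γ) (H' : IsLensCurve γ')
    {r : ℝ} (hr : 0 < r) (h : network γ = r • network γ') :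
    γ (-1) 0 = r * γ' (-1) 0 ∧ γ 1 0 = r * γ' 1 0 := by
  apply endpoints_eq_of_forall_iff H.left_lt_right (mul_lt_mul_of_pos_left H'.left_lt_right hr)
  intro x
  have h1 : (!₂[x, 0] : Plane) ∈ network γ ↔ (!₂[x, 0] : Plane) ∈ r • network γ' := by rw [h]
  rw [H.mem_network_of_eq_zero (by simp), mem_smul_set_iff_inv_smul_mem₀ hr.ne',
    H'.mem_network_of_eq_zero (by simp)] at h1
  simpa [inv_mul_le_iff₀ hr, le_inv_mul_iff₀ hr] using h1

/-- A curve that runs inside an embedded arc is tangent to it. -/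
theorem wedge_eq_zero_of_eventually_mem {γ c : ℝ → Plane} (cγ : ContinuousOn γ (Icc (-1) 1))
    (hinj : InjOn γ (Icc (-1) 1)) {s t : ℝ} (hs : s ∈ Ioo (-1 : ℝ) 1) {D C : Plane} (hD : D ≠ 0)
    (dγ : HasDerivAt γ D s) (dc : HasDerivAt c C t) (hct : c t = γ s)
    (hmem : ∀ᶠ τ in 𝓝 t, c τ ∈ γ '' Icc (-1) 1) : C 1 * D 0 - C 0 * D 1 = 0 := by
  have hL : LeftInvOn (Function.invFunOn γ (Icc (-1) 1)) γ (Icc (-1) 1) := hinj.leftInvOn_invFunOn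
  have cg := continuousOn_of_leftInvOn_of_isCompact isCompact_Icc cγ hL
  set g := Function.invFunOn γ (Icc (-1) 1)
  have hs' := Ioo_subset_Icc_self hs
  have hσ : Tendsto (fun τ => g (c τ)) (𝓝 t) (𝓝 s) := by
    have h1 : Tendsto c (𝓝 t) (𝓝[γ '' Icc (-1) 1] (γ s)) :=
      tendsto_nhdsWithin_iff.2 ⟨hct ▸ dc.continuousAt, hmem⟩
    have h2 := (cg (γ s) ⟨s, hs', rfl⟩).tendsto.comp h1
    rwa [hL hs'] at h2
  have hγσ : ∀ᶠ τ in 𝓝 t, γ (g (c τ)) = c τ := by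
    filter_upwards [hmem] with τ hτ
    obtain ⟨z, hz, hz'⟩ := hτ
    rw [← hz', hL hz]
  have dF : HasDerivAt (fun z => γ z 1 * D 0 - γ z 0 * D 1) 0 s :=
    (((hasDerivAt_plane.1 dγ).2.mul_const (D 0)).sub
      ((hasDerivAt_plane.1 dγ).1.mul_const (D 1))).congr_deriv (by ring)
  have dφ : HasDerivAt (fun τ => c τ 1 * D 0 - c τ 0 * D 1) (C 1 * D 0 - C 0 * D 1) t :=
    ((hasDerivAt_plane.1 dc).2.mul_const (D 0)).sub ((hasDerivAt_plane.1 dc).1.mul_const (D 1))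
  -- The functional `p ↦ p 1 * D 0 - p 0 * D 1` kills the tangent `D`, so along `γ` it changes by
  -- `o(z - s)`, which is `o(γ z - γ s)` because `D ≠ 0`. Substituting the continuous parameter `g
  -- (c τ)` turns this into `o(c τ - c t)`, hence `o(τ - t)`; no differentiability of that parameter
  -- is needed.
  have o1 : (fun z => (γ z 1 * D 0 - γ z 0 * D 1) - (γ s 1 * D 0 - γ s 0 * D 1))
      =o[𝓝 s] fun z => z - s := by
    have := hasDerivAt_iff_isLittleO.1 dF
    simpa using this
  have o2 : (fun z => z - s) =O[𝓝 s] fun z => γ z - γ s := by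
    have := (HasDerivAtFilter.isTheta_sub dγ hD).isBigO_symm.comp_tendsto
      (tendsto_id.prodMk (tendsto_const_pure : Tendsto (fun _ : ℝ => s) (𝓝 s) (pure s)))
    simpa [Function.comp_def] using this
  have o3 := (o1.trans_isBigO o2).comp_tendsto hσ
  have o4 : (fun τ => c τ - c t) =O[𝓝 t] fun τ => τ - t := dc.isBigO_sub
  have o5 : (fun τ => (c τ 1 * D 0 - c τ 0 * D 1) - (c t 1 * D 0 - c t 0 * D 1))
      =o[𝓝 t] fun τ => τ - t := by
    refine Asymptotics.IsLittleO.trans_isBigO (o3.congr' ?_ ?_) o4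
    · filter_upwards [hγσ] with τ hτ
      simp only [Function.comp, hτ, hct]
    · filter_upwards [hγσ] with τ hτ
      simp only [Function.comp, hτ, hct]
  refine dφ.unique (hasDerivAt_iff_isLittleO.2 ?_)
  simpa using o5

/-- The time slices of a self-similarly shrinking lens: the homothety factor `μ` relative to time
`t₀` is differentiable there, and the slice solves the corresponding curvature equation. -/
theorem IsSelfSimilarlyShrinkingLens.exists_curvature_eq {γ : ℝ → ℝ → Plane}
    (H : IsSelfSimilarlyShrinkingLens γ) {t₀ : ℝ} (ht₀ : t₀ < 0) :
    ∃ (μ : ℝ → ℝ) (c : ℝ), HasDerivAt μ c t₀ ∧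
      (∀ t < 0, γ t 1 0 = μ t * γ t₀ 1 0) ∧ ∀ s ∈ Ioo (-1 : ℝ) 1,
      c * (γ t₀ s 1 * deriv (γ t₀) s 0 - γ t₀ s 0 * deriv (γ t₀) s 1)
        * (deriv (γ t₀) s 0 ^ 2 + deriv (γ t₀) s 1 ^ 2)
        = deriv (deriv (γ t₀)) s 1 * deriv (γ t₀) s 0
          - deriv (deriv (γ t₀)) s 0 * deriv (γ t₀) s 1 := by
  have hr : ∀ t : ℝ, ∃ r : ℝ, t < 0 → 0 < r ∧ network (γ t) = r • network (γ t₀) := fun t => by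
    by_cases ht : t < 0
    · obtain ⟨r, h⟩ := H.homothetic t ht t₀ ht₀
      exact ⟨r, fun _ => h⟩
    · exact ⟨0, fun h => absurd h ht⟩
  choose μ hμ using hr
  have hL := H.lens t₀ ht₀
  have hend : ∀ t < 0, γ t (-1) 0 = μ t * γ t₀ (-1) 0 ∧ γ t 1 0 = μ t * γ t₀ 1 0 := fun t ht =>
    (H.lens t ht).endpoints_eq hL (hμ t ht).1 (hμ t ht).2
  have hneg : ∀ᶠ t in 𝓝 t₀, t < 0 := eventually_lt_nhds ht₀
  obtain ⟨c, hc⟩ : ∃ c, HasDerivAt μ c t₀ := by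
    -- The vertices are distinct, so one of them is not the origin; the ratio of its positions is
    -- `μ`, and it inherits differentiability in time.
    obtain ⟨e, he, he0, hee⟩ : ∃ e ∈ Icc (-1 : ℝ) 1, γ t₀ e 0 ≠ 0 ∧
        ∀ t < 0, γ t e 0 = μ t * γ t₀ e 0 := by
      by_cases h : γ t₀ 1 0 = 0
      · refine ⟨-1, by norm_num, ?_, fun t ht => (hend t ht).1⟩
        have := hL.left_lt_right
        rw [h] at this
        exact this.ne
      · exact ⟨1, by norm_num, h, fun t ht => (hend t ht).2⟩
    have hd := ((hasDerivAt_plane.1 (H.differentiable t₀ ht₀ e he).hasDerivAt).1).div_const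
      (γ t₀ e 0)
    refine ⟨_, hd.congr_of_eventuallyEq ?_⟩
    filter_upwards [hneg] with t ht
    rw [hee t ht, mul_div_cancel_right₀ _ he0]
  have hμ1 : μ t₀ = 1 := by
    have h1 := hend t₀ ht₀
    have h2 := hL.left_lt_right
    have h3 : (μ t₀ - 1) * (γ t₀ 1 0 - γ t₀ (-1) 0) = 0 := by linarith [h1.1, h1.2]
    rcases mul_eq_zero.1 h3 with h | h <;> linarith
  refine ⟨μ, c, hc, fun t ht => (hend t ht).2, fun s hs => ?_⟩
  have hs' := Ioo_subset_Icc_self hs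
  obtain ⟨dγ, -, dγ'⟩ := hL.hasDerivAt.2 s hs
  rw [← dγ'] at dγ
  have hD : deriv (γ t₀) s ≠ 0 := dγ' ▸ hL.regular s hs'
  have hA := (H.differentiable t₀ ht₀ s hs').hasDerivAt
  have hflow := (inner_unitNormal_eq_iff hD _ _).1 (H.flow t₀ ht₀ s hs)
  set A := deriv (fun τ => γ τ s) t₀
  have dinv : HasDerivAt (fun t => (μ t)⁻¹) (-c) t₀ := by
    have := hc.inv (by rw [hμ1]; exact one_ne_zero)
    rwa [hμ1, one_pow, div_one] at this
  -- The curve `t ↦ (μ t)⁻¹ • γ t s` stays on the fixed arc `γ t₀`, as only the arc of the network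
  -- lies above the axis. Its velocity `A - c • γ t₀ s` at `t₀` is therefore tangential.
  have hw := wedge_eq_zero_of_eventually_mem hL.smooth.continuousOn hL.embedded hs hD dγ
    (dinv.smul hA) (by simp [hμ1]) (by
      filter_upwards [hneg] with t ht
      obtain ⟨h1, h2⟩ := hμ t ht
      have h3 : 0 < γ t s 1 := (H.lens t ht).upper s hs
      have h4 : γ t s ∈ μ t • network (γ t₀) := h2 ▸ mem_network.2 (Or.inl ⟨s, hs', rfl⟩)
      rw [mem_smul_set_iff_inv_smul_mem₀ h1.ne'] at h4
      exact (hL.mem_network_of_pos (by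
        simpa using mul_pos (inv_pos.2 h1) h3)).1 h4)
  simp only [hμ1, inv_one, one_smul, PiLp.add_apply, PiLp.smul_apply, smul_eq_mul] at hw
  rw [← hflow]
  linear_combination (-(deriv (γ t₀) s 0 ^ 2 + deriv (γ t₀) s 1 ^ 2)) * hw

/-! ### Reflection symmetry and the rate of shrinking -/

theorem network_congr {γ γ' : ℝ → Plane} (h : γ '' Icc (-1) 1 = γ' '' Icc (-1) 1)
    (hl : γ (-1) 0 = γ' (-1) 0) (hr : γ 1 0 = γ' 1 0) : network γ = network γ' := by
  rw [network, network, h, hl, hr]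

theorem reflectAcrossX2_involutive : Function.Involutive reflectAcrossX2 := fun p => by
  apply plane_ext <;> simp [reflectAcrossX2]

theorem reflectAcrossX2_smul (r : ℝ) (p : Plane) :
    reflectAcrossX2 (r • p) = r • reflectAcrossX2 p := by
  apply plane_ext <;> simp [reflectAcrossX2]

theorem image_reflectAcrossX2_smul (r : ℝ) (S : Set Plane) :
    reflectAcrossX2 '' (r • S) = r • (reflectAcrossX2 '' S) := by
  rw [← image_smul, ← image_smul, image_image, image_image]
  simp only [reflectAcrossX2_smul]

open IsExtendedProfile in
/-- The network of an even graph is symmetric about the second axis. -/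
theorem image_reflectAcrossX2_network {b : ℝ} {u : ℝ → ℝ} (hb : 0 < b)
    (hev : ∀ x ∈ Icc (-b) b, u (-x) = u x) :
    reflectAcrossX2 '' network (graphCurve (-b) b u) = network (graphCurve (-b) b u) := by
  have hsub : ∀ p ∈ network (graphCurve (-b) b u),
      reflectAcrossX2 p ∈ network (graphCurve (-b) b u) := by
    have hneg : ∀ s ∈ Icc (-1 : ℝ) 1,
        graphCurve (-b) b u (-s) = reflectAcrossX2 (graphCurve (-b) b u s) := by
      intro s hs
      apply plane_ext
      · simp [graphCurve_zero, reflectAcrossX2]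
      · have := hev (s * b) ⟨by nlinarith [hs.1], by nlinarith [hs.2]⟩
        simp [graphCurve_one, reflectAcrossX2, this]
    have hneg' : ∀ s ∈ Icc (-1 : ℝ) 1, -s ∈ Icc (-1 : ℝ) 1 := fun s hs =>
      ⟨by linarith [hs.2], by linarith [hs.1]⟩
    intro p hp
    rw [mem_network]
    rcases mem_network.1 hp with ⟨s, hs, rfl⟩ | ⟨s, hs, rfl⟩ | h | h
    · exact Or.inl ⟨-s, hneg' s hs, hneg s hs⟩
    · refine Or.inr (Or.inl ⟨-s, hneg' s hs, ?_⟩)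
      rw [hneg s hs]
      apply plane_ext <;> simp [reflectAcrossX1, reflectAcrossX2]
    · refine Or.inr (Or.inr (Or.inr ?_))
      have h2 := h.2
      rw [graphCurve_zero] at h2 ⊢
      exact ⟨by simpa [reflectAcrossX2] using h.1, by simp [reflectAcrossX2]; linarith⟩
    · refine Or.inr (Or.inr (Or.inl ?_))
      have h2 := h.2
      rw [graphCurve_zero] at h2 ⊢
      exact ⟨by simpa [reflectAcrossX2] using h.1, by simp [reflectAcrossX2]; linarith⟩
  apply Subset.antisymm
  · rintro _ ⟨p, hp, rfl⟩
    exact hsub p hp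
  · intro p hp
    exact ⟨_, hsub p hp, reflectAcrossX2_involutive p⟩

/-- A positive function on `(-∞, 0)` with `L L' = -1` that does not stay away from zero is
`√(-2 t)`. -/
theorem eq_sqrt_of_hasDerivAt {L : ℝ → ℝ} (hpos : ∀ t < 0, 0 < L t)
    (hd : ∀ t < 0, HasDerivAt L (-(L t)⁻¹) t) (hlim : ∀ ε > 0, ∃ᶠ t in 𝓝[<] 0, L t < ε) :
    ∀ t < 0, L t = √(-2 * t) := by
  -- The equation makes `L² + 2t` constant; the rest of the proof shows that the constant is `0`.
  have hd2 : ∀ t ∈ Iio (0 : ℝ), HasDerivWithinAt (fun t => L t ^ 2 + 2 * t) 0 (Iio 0) t := by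
    intro t ht
    have h0 := (hpos t ht).ne'
    refine ((((hd t ht).pow 2).add ((hasDerivAt_id' t).const_mul 2)).congr_deriv
      ?_).hasDerivWithinAt
    push_cast
    field_simp
    ring
  have hconst : ∀ t < 0, ∀ t' < 0, L t ^ 2 + 2 * t = L t' ^ 2 + 2 * t' := by
    intro t ht t' ht'
    have h := (convex_Iio (0 : ℝ)).norm_image_sub_le_of_norm_hasDerivWithin_le hd2
      (C := 0) (by simp) ht' ht
    rwa [zero_mul, norm_le_zero_iff, sub_eq_zero] at h
  intro t ht
  have hle : L t ^ 2 + 2 * t ≤ 0 := by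
    by_contra! hgt
    obtain ⟨τ, h1, h2⟩ := ((hlim _ (Real.sqrt_pos.2 hgt)).and_eventually
      self_mem_nhdsWithin).exists
    have h3 := hconst t ht τ h2
    have h4 := (Real.lt_sqrt (hpos τ h2).le).1 h1
    have h5 : τ < 0 := h2
    linarith
  -- A negative constant `K` is impossible: at negative times beyond `K/4` it would give `L² ≤ K/2 <
  -- 0`.
  have hge : 0 ≤ L t ^ 2 + 2 * t := by
    by_contra! hlt
    have h2 : max t ((L t ^ 2 + 2 * t) / 4) < 0 := max_lt ht (by linarith)
    have h3 := hconst t ht _ h2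
    have h4 := sq_nonneg (L (max t ((L t ^ 2 + 2 * t) / 4)))
    have h5 := le_max_right t ((L t ^ 2 + 2 * t) / 4)
    linarith
  have : L t ^ 2 = -2 * t := by linarith
  rw [← this, Real.sqrt_sq (hpos t ht).le]

open IsExtendedProfile in
/-- The arc of a lens curve that is a rescaled shrinker arc determines its network. -/
theorem network_eq_smul_of_arc {γ : ℝ → Plane} {X Y u : ℝ → ℝ} {b k : ℝ} (hb : 0 < b)
    (hk : 0 < k) (hl : X (-(Real.pi / 3)) = -b) (hr : X (Real.pi / 3) = b)
    (hmem : ∀ θ ∈ Icc (-(Real.pi / 3)) (Real.pi / 3), X θ ∈ Icc (-b) b)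
    (hsurj : ∀ x ∈ Icc (-b) b, ∃ θ ∈ Icc (-(Real.pi / 3)) (Real.pi / 3), X θ = x)
    (hu : ∀ θ ∈ Icc (-(Real.pi / 3)) (Real.pi / 3), u (X θ) = Y θ)
    (el : X (-(Real.pi / 3)) = k * γ (-1) 0) (er : X (Real.pi / 3) = k * γ 1 0)
    (h1 : ∀ s ∈ Icc (-1 : ℝ) 1, ∃ θ ∈ Icc (-(Real.pi / 3)) (Real.pi / 3),
        X θ = k * γ s 0 ∧ Y θ = k * γ s 1)
    (h2 : ∀ θ ∈ Icc (-(Real.pi / 3)) (Real.pi / 3), ∃ s ∈ Icc (-1 : ℝ) 1,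
        X θ = k * γ s 0 ∧ Y θ = k * γ s 1) :
    network γ = k⁻¹ • network (graphCurve (-b) b u) := by
  rw [← network_smul (inv_pos.2 hk)]
  apply network_congr
  · apply Subset.antisymm
    · rintro _ ⟨s, hs, rfl⟩
      obtain ⟨θ, hθ, e0, e1⟩ := h1 s hs
      have hm := hmem θ hθ
      have hdiv : X θ / b * b = X θ := div_mul_cancel₀ _ hb.ne'
      refine ⟨X θ / b, ⟨by rw [le_div_iff₀ hb]; linarith [hm.1],
        by rw [div_le_iff₀ hb]; linarith [hm.2]⟩, ?_⟩
      apply plane_ext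
      · simp only [PiLp.smul_apply, smul_eq_mul, graphCurve_zero]
        rw [hdiv, e0, inv_mul_cancel_left₀ hk.ne']
      · simp only [PiLp.smul_apply, smul_eq_mul, graphCurve_one]
        rw [hdiv, hu θ hθ, e1, inv_mul_cancel_left₀ hk.ne']
    · rintro _ ⟨s, hs, rfl⟩
      obtain ⟨θ, hθ, hX⟩ := hsurj (s * b) ⟨by nlinarith [hs.1], by nlinarith [hs.2]⟩
      obtain ⟨z, hz, e0, e1⟩ := h2 θ hθ
      refine ⟨z, hz, ?_⟩
      apply plane_ext
      · simp only [PiLp.smul_apply, smul_eq_mul, graphCurve_zero]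
        rw [← hX, e0, inv_mul_cancel_left₀ hk.ne']
      · simp only [PiLp.smul_apply, smul_eq_mul, graphCurve_one]
        rw [← hX, hu θ hθ, e1, inv_mul_cancel_left₀ hk.ne']
  · simp only [PiLp.smul_apply, smul_eq_mul, graphCurve_zero]
    rw [neg_one_mul, ← hl, el, inv_mul_cancel_left₀ hk.ne']
  · simp only [PiLp.smul_apply, smul_eq_mul, graphCurve_zero]
    rw [one_mul, ← hr, er, inv_mul_cancel_left₀ hk.ne']

/-- The distance of a point to the axis is at least its height. Applied to the middle point of the
arc, this turns collapse into convergence of the scale to zero. -/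
theorem ofReal_abs_le_hausdorffEDist {S : Set Plane} {p : Plane} (hp : p ∈ S) :
    ENNReal.ofReal |p 1| ≤ Metric.hausdorffEDist S x1Axis := by
  refine le_trans ?_ (Metric.infEDist_le_hausdorffEDist_of_mem hp)
  rw [Metric.le_infEDist]
  intro q hq
  have hq1 : q 1 = 0 := hq
  rw [edist_dist, dist_eq_norm]
  apply ENNReal.ofReal_le_ofReal
  have := PiLp.norm_apply_le (p - q) 1
  simpa [hq1] using this

/-! ### Existence and uniqueness of the self-similar lens -/

theorem lemma5p2 :
    ∃ (b : ℝ) (u : ℝ → ℝ),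
      -- the self-similar lens: a profile, symmetric about the `x^2`-axis, whose homothetic
      -- images form a self-similarly shrinking lens
      0 < b ∧ IsSelfSimilarProfile (-b) b u ∧
      (∀ x ∈ Icc (-b) b, u (-x) = u x) ∧ deriv u 0 = 0 ∧
      IsSelfSimilarlyShrinkingLens (fun t s => √(-2 * t) • graphCurve (-b) b u s) ∧
      -- it is the only one among all lens-shaped networks; in particular every
      -- self-similarly shrinking lens is symmetric about the `x^2`-axis
      (∀ γ : ℝ → ℝ → Plane, IsSelfSimilarlyShrinkingLens γ → ∀ t < 0,
        network (γ t) = √(-2 * t) • network (graphCurve (-b) b u) ∧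
        reflectAcrossX2 '' network (γ t) = network (γ t)) ∧
      -- the profile is the only solution of its free boundary value problem
      (∀ (a' b' : ℝ) (v : ℝ → ℝ), IsSelfSimilarProfile a' b' v →
        a' = -b ∧ b' = b ∧ EqOn v u (Icc (-b) b) ∧ deriv v 0 = 0) := by
  obtain ⟨X, Y, H, hext⟩ := exists_shrinkerArc
  obtain ⟨b, c₀, c₁, u, u₁, hb, hc₀, hc₁, hXb, hd, hu, hsurj⟩ := exists_graph_of_shrinkerArc H hext
  have hpi := Real.pi_pos
  have hl : -(Real.pi / 3) ∈ Icc (-(Real.pi / 3)) (Real.pi / 3) := ⟨le_rfl, by linarith⟩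
  have hr : Real.pi / 3 ∈ Icc (-(Real.pi / 3)) (Real.pi / 3) := ⟨by linarith, le_rfl⟩
  have h0 : (0 : ℝ) ∈ Icc (-(Real.pi / 3)) (Real.pi / 3) := ⟨by linarith, by linarith⟩
  have hXl : X (-(Real.pi / 3)) = -b := by rw [(H.symm hr).1, hXb]
  have hX0 : X 0 = 0 := by have := (H.symm h0).1; rw [neg_zero] at this; linarith
  have hmem : ∀ θ ∈ Icc (-(Real.pi / 3)) (Real.pi / 3), X θ ∈ Icc (-b) b := fun θ hθ =>
    ⟨hXl ▸ H.strictMonoOn_X.monotoneOn hl hθ hθ.1, hXb ▸ H.strictMonoOn_X.monotoneOn hθ hr hθ.2⟩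
  have hupos : ∀ x ∈ Ioo (-b) b, 0 < u x := by
    intro x hx
    obtain ⟨θ, hθ, rfl⟩ := hsurj x (Ioo_subset_Icc_self hx)
    rw [(hu θ hθ).1]
    have hlt : -(Real.pi / 3) < θ := hθ.1.lt_of_ne fun h => by
      rw [← h, hXl] at hx; exact hx.1.ne rfl
    have hgt : θ < Real.pi / 3 := hθ.2.lt_of_ne fun h => by
      rw [h, hXb] at hx; exact hx.2.ne rfl
    rcases le_total 0 θ with h | h
    · exact H.Y_pos_of_nonneg h hgt
    · rw [← (H.symm hθ).2]
      exact H.Y_pos_of_nonneg (by linarith) (by linarith)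
  have hev : ∀ x ∈ Icc (-b) b, u (-x) = u x := by
    intro x hx
    obtain ⟨θ, hθ, rfl⟩ := hsurj x hx
    have hθ' : -θ ∈ Icc (-(Real.pi / 3)) (Real.pi / 3) :=
      ⟨by linarith [hθ.2], by linarith [hθ.1]⟩
    rw [← (H.symm hθ).1, (hu _ hθ').1, (hu _ hθ).1, (H.symm hθ).2]
  have HE : IsExtendedProfile b c₀ c₁ u u₁ := by
    refine ⟨hb, hc₀, hc₁, hd, hupos, ?_, ?_, ?_, ?_⟩
    · rw [← hXl, (hu _ hl).1, H.left_eq]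
    · rw [← hXb, (hu _ hr).1, H.right_eq]
    · rw [← hXl, (hu _ hl).2, Real.tan_neg, neg_neg, Real.tan_pi_div_three]
    · rw [← hXb, (hu _ hr).2, Real.tan_pi_div_three]
  have hu0 : deriv u 0 = 0 := by
    rw [(hd 0 (HE.subset ⟨by linarith, hb.le⟩)).1.deriv]
    have := (hu 0 h0).2
    rwa [hX0, Real.tan_zero, neg_zero] at this
  refine ⟨b, u, hb, HE.isSelfSimilarProfile, hev, hu0, HE.isSelfSimilarlyShrinkingLens, ?_, ?_⟩
  · intro γ hγ
    -- Each slice is the model network scaled by `1/k`; its curvature factor `-k²` is also the time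
    -- derivative of the homothety factor `μ`.
    have slice : ∀ t < 0, ∃ (k : ℝ) (μ : ℝ → ℝ), 0 < k ∧ b = k * γ t 1 0 ∧
        network (γ t) = k⁻¹ • network (graphCurve (-b) b u) ∧ HasDerivAt μ (-k ^ 2) t ∧
        ∀ τ < 0, γ τ 1 0 = μ τ * γ t 1 0 := by
      intro t ht
      obtain ⟨μ, c, hμ, hμ', heq⟩ := hγ.exists_curvature_eq ht
      obtain ⟨k, X', Y', hk, hc, H', el, er, h1, h2⟩ := (hγ.lens t ht).exists_shrinkerArc heq
      obtain ⟨eX, eY⟩ := H'.unique H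
      rw [eX hl] at el
      rw [eX hr] at er
      refine ⟨k, μ, hk, hXb ▸ er, ?_, hc ▸ hμ, hμ'⟩
      refine network_eq_smul_of_arc hb hk hXl hXb hmem hsurj (fun θ hθ => (hu θ hθ).1) el er ?_ ?_
      · intro s hs
        obtain ⟨θ, hθ, e⟩ := h1 s hs
        exact ⟨θ, hθ, by rwa [eX hθ, eY hθ] at e⟩
      · intro θ hθ
        obtain ⟨s, hs, e⟩ := h2 θ hθ
        exact ⟨s, hs, by rwa [eX hθ, eY hθ] at e⟩
    have hinv : ∀ {k x : ℝ}, 0 < k → b = k * x → x / b = k⁻¹ := by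
      intro k x hk h
      have hx : x ≠ 0 := by
        rintro rfl
        rw [mul_zero] at h
        exact hb.ne' h
      rw [h]
      field_simp
    have hnet : ∀ t < 0, 0 < γ t 1 0 / b ∧
        network (γ t) = (γ t 1 0 / b) • network (graphCurve (-b) b u) := by
      intro t ht
      obtain ⟨k, μ, hk, hkb, hn, -, -⟩ := slice t ht
      rw [hinv hk hkb]
      exact ⟨inv_pos.2 hk, hn⟩
    -- The scale `L = 1/k` satisfies `L(τ) = μ(τ) L(t)`, hence `L'(t) = -k² / k = -1/L(t)`.
    have hL : ∀ t < 0, γ t 1 0 / b = √(-2 * t) := by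
      refine eq_sqrt_of_hasDerivAt (fun t ht => (hnet t ht).1) ?_ ?_
      · intro t ht
        obtain ⟨k, μ, hk, hkb, -, hμ, hμ'⟩ := slice t ht
        have e := hinv hk hkb
        rw [e, inv_inv]
        refine ((hμ.mul_const (k⁻¹)).congr_deriv (by field_simp)).congr_of_eventuallyEq ?_
        filter_upwards [eventually_lt_nhds ht] with τ hτ
        rw [hμ' τ hτ, mul_div_assoc, e]
      · intro ε hε
        have hm : 0 < u 0 := hupos 0 ⟨by linarith, hb⟩
        have h1 : ∀ᶠ t in 𝓝[<] 0, Metric.hausdorffEDist (network (γ t)) x1Axis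
            < ENNReal.ofReal (ε * u 0) :=
          hγ.collapse.eventually_lt_const (ENNReal.ofReal_pos.2 (by positivity))
        refine Eventually.frequently ?_
        filter_upwards [h1, self_mem_nhdsWithin] with t ht ht0
        obtain ⟨hp, hn⟩ := hnet t ht0
        have hmem : (γ t 1 0 / b) • graphCurve (-b) b u 0 ∈ network (γ t) := by
          rw [hn]
          exact smul_mem_smul_set (mem_network.2 (Or.inl ⟨0, by norm_num, rfl⟩))
        have h2 := (ofReal_abs_le_hausdorffEDist hmem).trans_lt ht
        rw [PiLp.smul_apply, IsExtendedProfile.graphCurve_one, zero_mul, smul_eq_mul,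
          abs_of_pos (mul_pos hp hm), ENNReal.ofReal_lt_ofReal_iff (by positivity)] at h2
        exact lt_of_mul_lt_mul_right h2 hm.le
    intro t ht
    have hn := (hnet t ht).2
    rw [hL t ht] at hn
    exact ⟨hn, by rw [hn, image_reflectAcrossX2_smul, image_reflectAcrossX2_network hb hev]⟩
  · intro a' b' v hv
    obtain ⟨X', Y', H', el, er, -, hv'⟩ := hv.exists_shrinkerArc
    obtain ⟨eX, eY⟩ := H'.unique H
    have hEq : EqOn v u (Icc (-b) b) := by
      intro x hx
      obtain ⟨θ, hθ, rfl⟩ := hsurj x hx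
      rw [(hu θ hθ).1, ← eX hθ, hv' θ hθ, eY hθ]
    refine ⟨by rw [← el, eX hl, hXl], by rw [← er, eX hr, hXb], hEq, ?_⟩
    refine (Filter.EventuallyEq.deriv_eq ?_).trans hu0
    filter_upwards [Icc_mem_nhds (by linarith : -b < 0) hb] with x hx using hEq hx
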